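/- Let $\mathcal M=(S,A,T,R,\beta,L,\Phi)$ be a labeled Markov decision process with finite state space $S$, a nonempty finite set $A(s)$ of available actions at each state $s$, transition probabilities $T(s'|s,a)$, rewards $R(s,a,s')$ with $R(s,a):=\sum_{s'}T(s'|s,a)R(s,a,s')$, initial distribution $\beta$, and finitely many specifications $\Phi=\{(L_i,[l_i,u_i])\}_i$ with $L_i\subseteq S$. The transition graph of $\mathcal M$ has an edge $s\to s'$ iff $T(s'|s,a)>0$ for some $a\in A(s)$; that of a Markov chain has an edge $s\to s'$ iff its transition probability from $s$ to $s'$ is positive. A terminal strongly connected component (TSCC) is a strongly connected component of the transition graph that has no outgoing edges and is reachable from some state $s$ with $\beta_s>0$. Let $r(\mathcal M)$ be the union of all TSCCs of $\mathcal M$, and, for a stationary policy $\pi$ (a distribution $\pi(\cdot|s)$ on $A(s)$ for each $s$), let $r(\mathcal M_\pi)$ be the union of all TSCCs of the induced chain with transition function $T_\pi(s'|s)=\sum_{a\in A(s)}T(s'|s,a)\pi(a|s)$ and initial distribution $\beta$. The set of edge-preserving policies is $$\Pi_{EP}=\{\pi \text{ stationary}: r(\mathcal M_\pi)=r(\mathcal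 M),\ \pi(a|s)>0\ \ \forall s\in r(\mathcal M),\,a\in A(s)\}.$$ With $S_0\sim\beta$, the occupation measure of $\pi$ is $\mathrm{Pr}^\infty_\pi(s,a)=\lim_n\frac1n\sum_{t=1}^n\Pr(S_t=s,A_t=a)$ and its expected average reward is $R^\infty_\pi(\beta)=\liminf_n\frac1n\sum_{t=1}^n\mathbb E[R(S_t,A_t)]$. The policy $\pi$ meets the specifications if $l_i\le\sum_{s\in L_i}\sum_{a\in A(s)}\mathrm{Pr}^\infty_\pi(s,a)\le u_i$ for all $i$. For $\epsilon>0$ let $\mathrm{LP}_1(\epsilon)$ be the linear program: maximize $\sum_{s}\sum_{a\in A(s)}x_{sa}R(s,a)$ over $x=(x_{sa})$, $y=(y_{sa})$, $s\in S$, $a\in A(s)$, subject to - $\sum_s\sum_{a\in A(s)} x_{sa}T(s'|s,a)=\sum_{a\in A(s')}x_{s'a}$ for all $s'\in S$; - $\sum_s\sum_{a\in A(s)} y_{sa}T(s'|s,a)=\sum_{a\in A(s')}(x_{s'a}+y_{s'a})-\beta_{s'}$ for all $s'\in S$; - $\sum_{f\in S\setminus r(\mathcal M)}\sum_{a\in A(f)}x_{fa}=0$;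 - $x_{sa}\in[0,1]$, $y_{sa}\ge0$ for all $s\in S$, $a\in A(s)$; - $l_i\le\sum_{s\in L_i}\sum_{a\in A(s)}x_{sa}\le u_i$ for all $i$; - $x_{sa}\ge\epsilon$ for all $s\in r(\mathcal M)$, $a\in A(s)$. With $x_s=\sum_{a\in A(s)}x_{sa}$ and $y_s=\sum_{a\in A(s)}y_{sa}$, a policy $\pi(x,y)$ obtained from $(x,y)$ is a stationary policy with $\pi(a|s)=x_{sa}/x_s$ if $x_s>0$, $\pi(a|s)=y_{sa}/y_s$ if $x_s=0$ and $y_s>0$, and $\pi(\cdot|s)$ arbitrary otherwise. Then: 1. For every $\epsilon>0$, every policy obtained from a feasible solution of $\mathrm{LP}_1(\epsilon)$ is in $\Pi_{EP}$. 2. If $\pi\in\Pi_{EP}$ meets the specifications, then there are $\epsilon>0$ and $y$ such that $(\mathrm{Pr}^\infty_\pi,y)$ is feasible for $\mathrm{LP}_1(\epsilon)$. 3. Suppose that some policy in $\Pi_{EP}$ meets the specifications. Then $\mathrm{LP}_1(\epsilon)$ has an optimal solution for all sufficiently small $\epsilon>0$, the supremum below is finite, and if $\pi^*_\epsilon$ denotes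 any policy obtained from any optimal solution of $\mathrm{LP}_1(\epsilon)$, then $$\lim_{\epsilon\downarrow0}\Bigl(\sup\{R^\infty_\pi(\beta):\pi\in\Pi_{EP},\ \pi\text{ meets the specifications}\}-R^\infty_{\pi^*_\epsilon}(\beta)\Bigr)=0.$$ -/

import Mathlib

open Filter Topology

noncomputable section

/-- A Markov decision process with finite state space `S`, actions in `A`, and a nonempty finite
set `avail s` of available actions at every state `s`; `T s a s'` is `T(s' | s, a)`. Values of `T`
and `rew` at unavailable actions are irrelevant. -/
structure MDP (S A : Type*) [Fintype S] where
  avail : S → Finset A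
  avail_nonempty : ∀ s, (avail s).Nonempty
  T : S → A → S → ℝ
  T_nonneg : ∀ s, ∀ a ∈ avail s, ∀ s', 0 ≤ T s a s'
  T_sum : ∀ s, ∀ a ∈ avail s, ∑ s', T s a s' = 1
  rew : S → A → S → ℝ
  init : S → ℝ
  init_nonneg : ∀ s, 0 ≤ init s
  init_sum : ∑ s, init s = 1

/-- A labeled MDP: an MDP with finitely many steady-state specifications `(L_i, [l_i, u_i])`. -/
structure LMDP (S A : Type*) [Fintype S] extends MDP S A where
  numSpecs : ℕ
  label : Fin numSpecs → Finset S
  lo : Fin numSpecs → ℝ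
  hi : Fin numSpecs → ℝ

section Graph

variable {S : Type*}

/-- Strongly connected component of the directed graph with edge relation `E`: a maximal
(nonempty) set of vertices any two of which are joined by directed paths. -/
def IsSCC (E : S → S → Prop) (C : Set S) : Prop :=
  Maximal (fun D : Set S => D.Nonempty ∧ ∀ s ∈ D, ∀ s' ∈ D, Relation.ReflTransGen E s s') C

/-- Terminal strongly connected component: an SCC reachable from some initial state and without
outgoing edges. -/
def IsTSCC (E : S → S → Prop) (init : S → ℝ) (C : Set S) : Prop :=
  IsSCC E C ∧
  (∃ s, 0 < init s ∧ ∃ s' ∈ C, Relation.ReflTransGen E s s') ∧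
  (∀ s ∈ C, ∀ s', E s s' → s' ∈ C)

/-- The union of all TSCCs. -/
def tsccUnion (E : S → S → Prop) (init : S → ℝ) : Set S :=
  ⋃₀ {C : Set S | IsTSCC E init C}

end Graph

namespace MDP

variable {S A : Type*} [Fintype S] (M : MDP S A)

/-- Edges of the transition graph of the MDP. -/
def Edge (s s' : S) : Prop := ∃ a ∈ M.avail s, 0 < M.T s a s'

/-- The union `r(M)` of the TSCCs of the MDP. -/
def recurrentSet : Set S := tsccUnion M.Edge M.init

/-- `π s a` is `π(a | s)`; a stationary policy is a distribution over `A(s)` for each `s`. -/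
structure IsStationaryPolicy (π : S → A → ℝ) : Prop where
  nonneg : ∀ s a, 0 ≤ π s a
  support : ∀ s a, a ∉ M.avail s → π s a = 0
  sum_eq_one : ∀ s, ∑ a ∈ M.avail s, π s a = 1

/-- Transition function of the Markov chain induced by a policy. -/
def chainT (π : S → A → ℝ) (s s' : S) : ℝ := ∑ a ∈ M.avail s, M.T s a s' * π s a

/-- The union `r(M_π)` of the TSCCs of the Markov chain induced by `π`. -/
def chainRecurrentSet (π : S → A → ℝ) : Set S :=
  tsccUnion (fun s s' => 0 < M.chainT π s s') M.init

/-- Edge-preserving policies. -/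
def edgePreserving : Set (S → A → ℝ) :=
  {π | M.IsStationaryPolicy π ∧ M.chainRecurrentSet π = M.recurrentSet ∧
    ∀ s ∈ M.recurrentSet, ∀ a ∈ M.avail s, 0 < π s a}

/-- `Pr(S_t = s)` when `S_0` is distributed according to the initial distribution. -/
def stateLaw (π : S → A → ℝ) : ℕ → S → ℝ
  | 0 => M.init
  | t + 1 => fun s' => ∑ s, stateLaw π t s * M.chainT π s s'

/-- `Pr(S_t = s, A_t = a)`. -/
def stateActionLaw (π : S → A → ℝ) (t : ℕ) (s : S) (a : A) : ℝ := M.stateLaw π t s * π s a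

/-- `p` is the steady-state distribution (occupation measure) of `π`: the limit of the averages
over times `1, …, n` exists and equals `p`. -/
def HasOccupationMeasure (π p : S → A → ℝ) : Prop :=
  ∀ s a, Tendsto (fun n : ℕ => (1 / (n : ℝ)) * ∑ t ∈ Finset.Icc 1 n, M.stateActionLaw π t s a)
    atTop (𝓝 (p s a))

/-- `R(s, a)`. -/
def meanReward (s : S) (a : A) : ℝ := ∑ s', M.T s a s' * M.rew s a s'

/-- Expected average reward of a policy. -/
def avgReward (π : S → A → ℝ) : ℝ :=
  liminf (fun n : ℕ => (1 / (n : ℝ)) * ∑ t ∈ Finset.Icc 1 n,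
    ∑ s, ∑ a ∈ M.avail s, M.stateActionLaw π t s a * M.meanReward s a) atTop

/-- `x_s`, the sum of `x_{sa}` over the available actions. -/
def marg (x : S → A → ℝ) (s : S) : ℝ := ∑ a ∈ M.avail s, x s a

/-- `π` is a policy obtained from `(x, y)`; it is an arbitrary distribution over `A(s)` at the
states with `x_s = y_s = 0`. -/
structure IsInducedPolicy (x y π : S → A → ℝ) : Prop where
  stationary : M.IsStationaryPolicy π
  of_x : ∀ s, 0 < M.marg x s → ∀ a ∈ M.avail s, π s a = x s a / M.marg x s
  of_y : ∀ s, ¬ 0 < M.marg x s → 0 < M.marg y s → ∀ a ∈ M.avail s, π s a = y s a / M.marg y s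

open Classical in
/-- The constraint set `Q_0`. -/
structure MemQ0 (x y : S → A → ℝ) : Prop where
  stationary : ∀ s', ∑ s, ∑ a ∈ M.avail s, x s a * M.T s a s' = ∑ a ∈ M.avail s', x s' a
  flow : ∀ s', ∑ s, ∑ a ∈ M.avail s, y s a * M.T s a s' =
    ∑ a ∈ M.avail s', (x s' a + y s' a) - M.init s'
  transient : ∑ f with f ∉ M.recurrentSet, ∑ a ∈ M.avail f, x f a = 0
  x_mem : ∀ s, ∀ a ∈ M.avail s, x s a ∈ Set.Icc (0 : ℝ) 1
  y_nonneg : ∀ s, ∀ a ∈ M.avail s, 0 ≤ y s a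

/-- The objective of the linear program. -/
def objective (x : S → A → ℝ) : ℝ := ∑ s, ∑ a ∈ M.avail s, x s a * M.meanReward s a

end MDP

namespace LMDP

variable {S A : Type*} [Fintype S] (M : LMDP S A)

/-- The state-action distribution `p` satisfies all steady-state specifications. -/
def SatisfiesSpecs (p : S → A → ℝ) : Prop :=
  ∀ i, M.lo i ≤ ∑ s ∈ M.label i, ∑ a ∈ M.avail s, p s a ∧
    ∑ s ∈ M.label i, ∑ a ∈ M.avail s, p s a ≤ M.hi i

/-- The policy `π` meets the specifications: its steady-state distribution satisfies them. -/
def MeetsSpecs (π : S → A → ℝ) : Prop :=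
  ∃ p, M.HasOccupationMeasure π p ∧ M.SatisfiesSpecs p

/-- Feasible points of `LP_1(ε)`. -/
structure LPFeasible (ε : ℝ) (x y : S → A → ℝ) : Prop where
  memQ0 : M.MemQ0 x y
  specs : M.SatisfiesSpecs x
  lower : ∀ s ∈ M.recurrentSet, ∀ a ∈ M.avail s, ε ≤ x s a

/-- Optimal solutions of `LP_1(ε)`. -/
def LPOptimal (ε : ℝ) (x y : S → A → ℝ) : Prop :=
  M.LPFeasible ε x y ∧ ∀ x' y', M.LPFeasible ε x' y' → M.objective x' ≤ M.objective x

end LMDP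

end

/-! For a stochastic matrix `P` acting on row vectors, each vector splits as `v = k + (w - wP)` with
`k` stationary, and `k` is the limit of the time averages of `vP^t`. For `v = β` this `k` is the
state occupation measure, positive exactly on the TSCCs (`stationary_part_pos_iff`). The flow
constraint of the LP is this splitting in disguise, with `x` as `k` and `y` as `w`.

From policy to LP, `w` must be made nonnegative. Normalised to have vanishing averages, it is
already nonnegative where `k` vanishes (`exists_potential`), and adding a multiple of `k` repairs
the rest.

From LP to policy, the policy follows `x` rather than `y` on the recurrent set `R`, so the flow
constraint there is not a splitting for the induced chain. What survives is a flow from the sources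
`β` to the sinks `x` (`IsAbsorbingFlow`). Conservation across closed sets shows that the TSCCs fill
exactly `R` and that each class absorbs the mass `x` assigns to it. Mass on each class determines a
stationary vector supported on recurrent states, so `x` is the occupation measure.

Hence the objective at a feasible point is the reward of the policy obtained from it. As `ε`
decreases, the feasible set eventually contains the occupation measure of any admissible policy,
which gives the limit. Optima exist by compactness once `y`, unbounded in the LP, is replaced by a
bounded choice (`exists_bounded_nonneg_preimage`). -/

noncomputable section

/-! ### Ergodic averages of a finite chain. -/

/-- A stochastic matrix, given by its entries. -/
structure IsStochastic {S : Type*} [Fintype S] (P : S → S → ℝ) : Prop where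
  nonneg : ∀ s s', 0 ≤ P s s'
  sum_eq_one : ∀ s, ∑ s', P s s' = 1

/-- One step of the chain with transition function `P`, acting on row vectors. -/
def chainStep {S : Type*} [Fintype S] (P : S → S → ℝ) : (S → ℝ) →ₗ[ℝ] (S → ℝ) where
  toFun v := fun s' => ∑ s, v s * P s s'
  map_add' v w := by
    funext s'
    simp [add_mul, Finset.sum_add_distrib]
  map_smul' c v := by
    funext s'
    simp [Finset.mul_sum, mul_assoc]

section Chain

variable {S : Type*} [Fintype S] {P : S → S → ℝ}

theorem chainStep_apply (P : S → S → ℝ) (v : S → ℝ) (s' : S) :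
    chainStep P v s' = ∑ s, v s * P s s' := rfl

namespace IsStochastic

theorem chainStep_nonneg (hP : IsStochastic P) {v : S → ℝ} (hv : ∀ s, 0 ≤ v s) (s : S) :
    0 ≤ chainStep P v s :=
  Finset.sum_nonneg fun i _ => mul_nonneg (hv i) (hP.nonneg i s)

theorem sum_chainStep (hP : IsStochastic P) (v : S → ℝ) : ∑ s, chainStep P v s = ∑ s, v s := by
  simp only [chainStep_apply]
  rw [Finset.sum_comm]
  simp [← Finset.mul_sum, hP.sum_eq_one]

theorem abs_chainStep_le (hP : IsStochastic P) (v : S → ℝ) (s : S) :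
    |chainStep P v s| ≤ chainStep P (fun s => |v s|) s := by
  refine (Finset.abs_sum_le_sum_abs _ _).trans_eq (Finset.sum_congr rfl fun i _ => ?_)
  rw [abs_mul, abs_of_nonneg (hP.nonneg i s)]

theorem sum_abs_chainStep_le (hP : IsStochastic P) (v : S → ℝ) :
    ∑ s, |chainStep P v s| ≤ ∑ s, |v s| :=
  (Finset.sum_le_sum fun s _ => hP.abs_chainStep_le v s).trans_eq (hP.sum_chainStep _)

theorem pow_chainStep_nonneg (hP : IsStochastic P) {v : S → ℝ} (hv : ∀ s, 0 ≤ v s) (n : ℕ) :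
    ∀ s, 0 ≤ (chainStep P ^ n) v s := by
  induction n with
  | zero => simpa using hv
  | succ n ih =>
    rw [pow_succ', Module.End.mul_apply]
    exact hP.chainStep_nonneg ih

theorem abs_pow_chainStep_le (hP : IsStochastic P) (v : S → ℝ) (n : ℕ) (s : S) :
    |(chainStep P ^ n) v s| ≤ ∑ s, |v s| := by
  have h : ∑ s, |(chainStep P ^ n) v s| ≤ ∑ s, |v s| := by
    induction n with
    | zero => simp
    | succ n ih =>
      rw [pow_succ', Module.End.mul_apply]
      exact (hP.sum_abs_chainStep_le _).trans ih
  exact (Finset.single_le_sum (f := fun s => |(chainStep P ^ n) v s|)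
    (fun i _ => abs_nonneg _) (Finset.mem_univ s)).trans h

end IsStochastic

/-- The coboundary part telescopes in time, so sums over time equal `n • k` up to a bounded
remainder. -/
theorem pow_chainStep_eq {k w v : S → ℝ} (hk : chainStep P k = k)
    (hv : v = k + (w - chainStep P w)) (t : ℕ) :
    (chainStep P ^ t) v = k + ((chainStep P ^ t) w - (chainStep P ^ (t + 1)) w) := by
  have hkt : (chainStep P ^ t) k = k := by
    induction t with
    | zero => simp
    | succ n ih => rw [pow_succ', Module.End.mul_apply, ih, hk]
  rw [hv, map_add, hkt, map_sub, pow_succ, Module.End.mul_apply]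

theorem sum_range_pow_chainStep {k w v : S → ℝ} (hk : chainStep P k = k)
    (hv : v = k + (w - chainStep P w)) (n : ℕ) :
    ∑ t ∈ Finset.range n, (chainStep P ^ t) v = (n : ℝ) • k + (w - (chainStep P ^ n) w) := by
  simp_rw [pow_chainStep_eq hk hv]
  rw [Finset.sum_add_distrib, Finset.sum_range_sub' (fun t => (chainStep P ^ t) w)]
  simp only [Finset.sum_const, Finset.card_range, pow_zero, Module.End.one_apply]
  rw [← Nat.cast_smul_eq_nsmul ℝ]

theorem sum_Icc_pow_chainStep {k w v : S → ℝ} (hk : chainStep P k = k)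
    (hv : v = k + (w - chainStep P w)) (n : ℕ) :
    ∑ t ∈ Finset.Icc 1 n, (chainStep P ^ t) v
      = (n : ℝ) • k + (chainStep P w - (chainStep P ^ (n + 1)) w) := by
  have h := sum_range_pow_chainStep hk
    (v := chainStep P v) (w := chainStep P w) (by rw [hv]; simp [hk]) n
  rw [pow_succ, Module.End.mul_apply, ← h, ← Finset.Ico_add_one_right_eq_Icc,
    Finset.sum_Ico_eq_sum_range]
  refine Finset.sum_congr (by simp) fun t _ => ?_
  rw [add_comm 1 t, pow_succ, Module.End.mul_apply]

namespace IsStochastic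

/-- Mean ergodic theorem for finite chains. -/
theorem tendsto_average (hP : IsStochastic P) {k w v : S → ℝ} (hk : chainStep P k = k)
    (hv : v = k + (w - chainStep P w)) (s : S) :
    Tendsto (fun n : ℕ => (1 / (n : ℝ)) * ∑ t ∈ Finset.Icc 1 n, (chainStep P ^ t) v s)
      atTop (𝓝 (k s)) := by
  have hsum : ∀ n : ℕ, ∑ t ∈ Finset.Icc 1 n, (chainStep P ^ t) v s
      = n * k s + (chainStep P w s - (chainStep P ^ (n + 1)) w s) := by
    intro n
    have := congrFun (sum_Icc_pow_chainStep hk hv n) s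
    simpa [Finset.sum_apply] using this
  have hz : Tendsto (fun n : ℕ => (1 / (n : ℝ)) *
      (chainStep P w s - (chainStep P ^ (n + 1)) w s)) atTop (𝓝 0) := by
    refine squeeze_zero_norm (a := fun n : ℕ => (1 / (n : ℝ)) * (2 * ∑ s, |w s|)) ?_ ?_
    · intro n
      rw [norm_mul, Real.norm_of_nonneg (by positivity : (0 : ℝ) ≤ 1 / n), Real.norm_eq_abs]
      refine mul_le_mul_of_nonneg_left ?_ (by positivity)
      have h1 := hP.abs_pow_chainStep_le w 1 s
      have h2 := hP.abs_pow_chainStep_le w (n + 1) s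
      rw [pow_one] at h1
      have := abs_sub (chainStep P w s) ((chainStep P ^ (n + 1)) w s)
      linarith
    · simpa using (tendsto_one_div_atTop_nhds_zero_nat (𝕜 := ℝ)).mul_const (2 * ∑ s, |w s|)
  have := hz.const_add (k s)
  rw [add_zero] at this
  refine this.congr' ?_
  -- At `n = 0` the average is `0`, since `1 / 0 = 0`.
  filter_upwards [eventually_gt_atTop 0] with n hn
  have : (n : ℝ) ≠ 0 := by positivity
  rw [hsum]
  field_simp

/-- Every vector is the sum of a stationary vector and a coboundary. -/
theorem exists_decomposition (hP : IsStochastic P) (v : S → ℝ) :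
    ∃ k w, chainStep P k = k ∧ v = k + (w - chainStep P w) := by
  set g : (S → ℝ) →ₗ[ℝ] (S → ℝ) := LinearMap.id - chainStep P with hg
  -- A stationary coboundary has averages tending both to itself and to `0`. Rank-nullity then makes
  -- kernel and range complementary.
  have hdisj : Disjoint (LinearMap.ker g) (LinearMap.range g) := by
    rw [Submodule.disjoint_def]
    rintro u hu ⟨w, rfl⟩
    have hu' : chainStep P (g w) = g w := by
      have : g w - chainStep P (g w) = 0 := hu
      exact (sub_eq_zero.mp this).symm
    funext s
    have h1 := hP.tendsto_average hu' (v := g w) (w := 0) (by simp) s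
    have h2 := hP.tendsto_average (k := 0) (v := g w) (w := w) (by simp) (by simp [hg]) s
    exact tendsto_nhds_unique h1 h2
  have htop := Submodule.eq_top_of_disjoint _ _
    (by rw [add_comm]; exact (LinearMap.finrank_range_add_finrank_ker g).ge) hdisj
  have hv : v ∈ LinearMap.ker g ⊔ LinearMap.range g := htop ▸ Submodule.mem_top
  obtain ⟨k, hk, _, ⟨w, rfl⟩, rfl⟩ := Submodule.mem_sup.mp hv
  refine ⟨k, w, ?_, by simp [hg]⟩
  have : k - chainStep P k = 0 := hk
  exact (sub_eq_zero.mp this).symm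

/-- The difference between a nonnegative vector and its stationary part is a coboundary whose
potential is nonnegative where the stationary part vanishes. -/
theorem exists_potential (hP : IsStochastic P) {v : S → ℝ} (hv : ∀ s, 0 ≤ v s) :
    ∃ k z, chainStep P k = k ∧ v = k + (z - chainStep P z) ∧ ∀ s, k s = 0 → 0 ≤ z s := by
  obtain ⟨k, w, hk, hkw⟩ := hP.exists_decomposition v
  -- Removing the stationary part of `w` leaves its coboundary unchanged and makes the averages of
  -- the potential vanish.
  obtain ⟨k', w', hk', hw'⟩ := hP.exists_decomposition w
  set z := w' - chainStep P w' with hz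
  have hvz : v = k + (z - chainStep P z) := by
    rw [hkw, hw', map_add, hk']
    abel
  refine ⟨k, z, hk, hvz, fun s hs => ?_⟩
  -- The partial sums `n • k + z - P^n z` are nonnegative, and `k s = 0`; averaging over `n` then
  -- gives `0 ≤ z s`.
  have hle : ∀ n, (chainStep P ^ n) z s ≤ z s := by
    intro n
    have h := congrFun (sum_range_pow_chainStep hk hvz n) s
    have h0 : 0 ≤ (∑ t ∈ Finset.range n, (chainStep P ^ t) v) s := by
      rw [Finset.sum_apply]
      exact Finset.sum_nonneg fun t _ => hP.pow_chainStep_nonneg hv t s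
    rw [h] at h0
    simp only [Pi.add_apply, Pi.smul_apply, hs, Pi.sub_apply, smul_zero, zero_add] at h0
    linarith
  have hlim := hP.tendsto_average (k := 0) (w := w') (v := z) (by simp) (by simp [hz]) s
  refine le_of_tendsto hlim ?_
  filter_upwards [eventually_gt_atTop 0] with n hn
  have hn' : (0 : ℝ) < n := by positivity
  have : ∑ t ∈ Finset.Icc 1 n, (chainStep P ^ t) z s ≤ n * z s := by
    refine (Finset.sum_le_card_nsmul _ _ _ fun t _ => hle t).trans ?_
    simp
  rw [one_div, inv_mul_le_iff₀ hn']
  exact this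

end IsStochastic

end Chain

/-! ### Terminal components in terms of reachability. -/

section Reachability

variable {S : Type*}

/-- The component of such an `s` is the set of all vertices reachable from it. -/
theorem mem_tsccUnion_iff (E : S → S → Prop) (init : S → ℝ) (s : S) :
    s ∈ tsccUnion E init ↔ (∃ s₀, 0 < init s₀ ∧ Relation.ReflTransGen E s₀ s) ∧
      ∀ s', Relation.ReflTransGen E s s' → Relation.ReflTransGen E s' s := by
  constructor
  · rintro ⟨C, ⟨⟨⟨_, hC⟩, _⟩, ⟨s₀, h₀, c, hc, hs₀c⟩, hclosed⟩, hs⟩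
    refine ⟨⟨s₀, h₀, hs₀c.trans (hC c hc s hs)⟩, fun s' hs' => hC s' ?_ s hs⟩
    induction hs' with
    | refl => exact hs
    | tail _ he ih => exact hclosed _ ih _ he
  · rintro ⟨⟨s₀, h₀, hs₀⟩, hrec⟩
    refine ⟨{s' | Relation.ReflTransGen E s s'}, ⟨⟨⟨⟨s, .refl⟩, ?_⟩, ?_⟩, ?_, ?_⟩, .refl⟩
    · exact fun u hu v hv => (hrec u hu).trans hv
    · exact fun D hD hle v hv => hD.2 s (hle .refl) v hv
    · exact ⟨s₀, h₀, s, .refl, hs₀⟩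
    · exact fun u hu v huv => Relation.ReflTransGen.tail hu huv

theorem mem_tsccUnion_of_reflTransGen {E : S → S → Prop} {init : S → ℝ} {s s' : S}
    (hs : s ∈ tsccUnion E init) (h : Relation.ReflTransGen E s s') :
    s' ∈ tsccUnion E init := by
  rw [mem_tsccUnion_iff] at hs ⊢
  obtain ⟨⟨s₀, h₀, hs₀⟩, hrec⟩ := hs
  exact ⟨⟨s₀, h₀, hs₀.trans h⟩, fun u hu => (hrec u (h.trans hu)).trans h⟩

end Reachability

/-! ### Stationary vectors and mass on closed sets. -/

section Chain

variable {S : Type*} [Fintype S] {P : S → S → ℝ}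

/-- Reachability in the transition graph of a chain. -/
def ChainReach (P : S → S → ℝ) : S → S → Prop :=
  Relation.ReflTransGen fun s s' => 0 < P s s'

open Classical in
/-- The mass that a vector gives to a set of states. -/
def massOn (v : S → ℝ) (C : Set S) : ℝ := ∑ s with s ∈ C, v s

theorem massOn_chainStep (v : S → ℝ) (C : Set S) :
    massOn (chainStep P v) C = ∑ s, v s * massOn (P s) C := by
  simp only [massOn, chainStep_apply, Finset.mul_sum]
  exact Finset.sum_comm

theorem massOn_pos {v : S → ℝ} {C : Set S} (hv : ∀ s ∈ C, 0 ≤ v s) {s : S} (hs : s ∈ C)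
    (h : 0 < v s) : 0 < massOn v C :=
  Finset.sum_pos' (fun i hi => hv i (by simpa using hi)) ⟨s, by simpa using hs, h⟩

theorem massOn_sub (v w : S → ℝ) (C : Set S) : massOn (v - w) C = massOn v C - massOn w C :=
  Finset.sum_sub_distrib ..

theorem massOn_eq_zero {v : S → ℝ} {C : Set S} (h : ∀ s ∈ C, v s = 0) : massOn v C = 0 :=
  Finset.sum_eq_zero fun i hi => h i (by simpa using hi)

theorem massOn_le_sum {v : S → ℝ} (hv : ∀ s, 0 ≤ v s) (C : Set S) : massOn v C ≤ ∑ s, v s := by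
  classical
  exact Finset.sum_le_sum_of_subset_of_nonneg (Finset.filter_subset _ _) fun i _ _ => hv i

theorem massOn_lt_sum {v : S → ℝ} (hv : ∀ s, 0 ≤ v s) {C : Set S} {s : S} (hs : s ∉ C)
    (hpos : 0 < v s) : massOn v C < ∑ s, v s := by
  classical
  exact Finset.sum_lt_sum_of_subset (Finset.filter_subset _ _) (Finset.mem_univ s) (by simpa using hs)
    hpos fun i _ _ => hv i

theorem massOn_nonneg {v : S → ℝ} {C : Set S} (h : ∀ s ∈ C, 0 ≤ v s) : 0 ≤ massOn v C :=
  Finset.sum_nonneg fun i hi => h i (by simpa using hi)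

open Classical in
theorem massOn_eq_sum_ite (v : S → ℝ) (C : Set S) :
    massOn v C = ∑ s, if s ∈ C then v s else 0 := by
  rw [massOn, Finset.sum_filter]

theorem massOn_eq_sum {v : S → ℝ} {C : Set S} (h : ∀ s, s ∉ C → v s = 0) :
    massOn v C = ∑ s, v s := by
  classical
  rw [massOn_eq_sum_ite]
  refine Finset.sum_congr rfl fun i _ => ?_
  split_ifs with hi
  · rfl
  · exact (h i hi).symm

theorem exists_pos_of_massOn_pos {v : S → ℝ} {C : Set S} (h : 0 < massOn v C) :
    ∃ s ∈ C, 0 < v s := by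
  classical
  obtain ⟨s, hs, hpos⟩ := Finset.exists_lt_of_sum_lt
    (s := Finset.univ.filter (· ∈ C)) (f := fun _ => (0 : ℝ)) (g := v)
    (by simpa [massOn] using h)
  exact ⟨s, by simpa using hs, hpos⟩

/-- Vectors supported on recurrent states without mass on any recurrent class. -/
structure IsBalanced (P : S → S → ℝ) (R : Set S) (g : S → ℝ) : Prop where
  support : ∀ s, s ∉ R → g s = 0
  mass : ∀ s ∈ R, massOn g {s' | ChainReach P s s'} = 0

namespace IsStochastic

theorem massOn_row_of_mem (hP : IsStochastic P) {C : Set S}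
    (hC : ∀ s ∈ C, ∀ s', 0 < P s s' → s' ∈ C) {s : S} (hs : s ∈ C) : massOn (P s) C = 1 := by
  rw [massOn_eq_sum, hP.sum_eq_one]
  intro s' hs'
  by_contra hne
  exact hs' (hC s hs s' ((hP.nonneg s s').lt_of_ne' hne))

theorem massOn_row_nonneg (hP : IsStochastic P) (C : Set S) (s : S) : 0 ≤ massOn (P s) C :=
  massOn_nonneg fun s' _ => hP.nonneg s s'

/-- A closed set loses no mass, and stationarity forbids a gain. -/
theorem edge_from_outside_eq_zero (hP : IsStochastic P) {k : S → ℝ} (hk : chainStep P k = k)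
    (hk0 : ∀ s, 0 ≤ k s) {C : Set S} (hC : ∀ s ∈ C, ∀ s', 0 < P s s' → s' ∈ C) {s s' : S}
    (hs : s ∉ C) (hs' : s' ∈ C) (hpos : 0 < k s) : P s s' = 0 := by
  classical
  by_contra hne
  have h := massOn_chainStep (P := P) k C
  rw [hk, massOn_eq_sum_ite] at h
  refine h.not_lt (Finset.sum_lt_sum (fun i _ => ?_) ⟨s, Finset.mem_univ s, ?_⟩)
  · split_ifs with hi
    · rw [hP.massOn_row_of_mem hC hi, mul_one]
    · exact mul_nonneg (hk0 i) (hP.massOn_row_nonneg C i)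
  · rw [if_neg hs]
    exact mul_pos hpos (massOn_pos (fun i _ => hP.nonneg s i) hs'
      ((hP.nonneg s s').lt_of_ne' hne))

theorem chainStep_pos (hP : IsStochastic P) {v : S → ℝ} (hv : ∀ s, 0 ≤ v s) {s s' : S}
    (hs : 0 < v s) (h : 0 < P s s') : 0 < chainStep P v s' :=
  Finset.sum_pos' (fun i _ => mul_nonneg (hv i) (hP.nonneg i s'))
    ⟨s, Finset.mem_univ s, mul_pos hs h⟩

theorem stationary_pos_of_reach (hP : IsStochastic P) {k : S → ℝ} (hk : chainStep P k = k)
    (hk0 : ∀ s, 0 ≤ k s) {s s' : S} (hs : 0 < k s) (h : ChainReach P s s') : 0 < k s' := by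
  induction h with
  | refl => exact hs
  | tail _ he ih =>
    rw [← hk]
    exact hP.chainStep_pos hk0 ih he

/-- Were there no return, a path from `s` would have to enter the closed set of states reachable
from `s'`, starting outside it, along an edge out of a state of positive mass. -/
theorem reach_symm_of_stationary_pos (hP : IsStochastic P) {k : S → ℝ} (hk : chainStep P k = k)
    (hk0 : ∀ s, 0 ≤ k s) {s s' : S} (hs : 0 < k s) (h : ChainReach P s s') :
    ChainReach P s' s := by
  by_contra hns
  have key : ∀ u, ChainReach P s u → ¬ ChainReach P s' u := by
    intro u hu
    induction hu with
    | refl => exact hns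
    | @tail b c hb hbc ih =>
      intro hc
      refine hbc.ne' (hP.edge_from_outside_eq_zero hk hk0 (C := {u | ChainReach P s' u})
        (fun a ha b hab => Relation.ReflTransGen.tail ha hab) ih hc
        (hP.stationary_pos_of_reach hk hk0 hs hb))
  exact key s' h .refl

/-- The triangle inequality gives `≤` pointwise, and both sides have the same total. -/
theorem chainStep_abs_eq (hP : IsStochastic P) {h : S → ℝ} (hh : chainStep P h = h) :
    chainStep P (fun s => |h s|) = fun s => |h s| := by
  have hle : ∀ s ∈ Finset.univ, |h s| ≤ chainStep P (fun s => |h s|) s := by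
    intro s _
    have := hP.abs_chainStep_le h s
    rwa [hh] at this
  have := (Finset.sum_eq_sum_iff_of_le hle).mp (hP.sum_chainStep _).symm
  funext s
  exact (this s (Finset.mem_univ s)).symm

/-- A stationary signed vector without mass on the sets reachable from its support vanishes. -/
theorem eq_zero_of_massOn_reach_eq_zero (hP : IsStochastic P) {h : S → ℝ}
    (hh : chainStep P h = h)
    (hmass : ∀ s, h s ≠ 0 → massOn h {s' | ChainReach P s s'} = 0) : h = 0 := by
  have key : ∀ g : S → ℝ, chainStep P g = g →
      (∀ s, g s ≠ 0 → massOn g {s' | ChainReach P s s'} = 0) → ∀ s, ¬ 0 < g s := by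
    intro g hg hm s hs
    -- Twice the positive part of `g` is stationary. Its positivity spreads from `s` to everything
    -- reachable, so `g` has positive mass there.
    set p : S → ℝ := (fun s => |g s|) + g with hp
    have hpst : chainStep P p = p := by rw [hp, map_add, hP.chainStep_abs_eq hg, hg]
    have hp0 : ∀ s, 0 ≤ p s := fun s => by
      have := neg_abs_le (g s)
      simp only [hp, Pi.add_apply]
      linarith
    have hpos : ∀ s', ChainReach P s s' → 0 < g s' := by
      intro s' hs'
      have h1 : 0 < p s := by
        simp only [hp, Pi.add_apply]
        positivity
      have h2 := hP.stationary_pos_of_reach hpst hp0 h1 hs'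
      simp only [hp, Pi.add_apply] at h2
      by_contra hle
      rw [abs_of_nonpos (not_lt.mp hle)] at h2
      simp at h2
    exact (massOn_pos (C := {s' | ChainReach P s s'}) (fun u hu => (hpos u hu).le)
      (s := s) Relation.ReflTransGen.refl hs).ne' (hm s hs.ne')
  funext s
  have h1 := key h hh hmass s
  have h2 := key (-h) (by rw [map_neg, hh]) (fun s hs => by
    have := hmass s (by simpa using hs)
    simpa [massOn] using this) s
  simp only [Pi.neg_apply, Left.neg_pos_iff] at h2
  exact le_antisymm (not_lt.mp h1) (not_lt.mp h2)

/-- A recurrent class keeps its mass and receives none from other recurrent states. -/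
theorem isBalanced_chainStep (hP : IsStochastic P) {R : Set S}
    (hR : ∀ s ∈ R, ∀ s', 0 < P s s' → s' ∈ R)
    (hrec : ∀ s ∈ R, ∀ s', ChainReach P s s' → ChainReach P s' s) {g : S → ℝ}
    (hg : IsBalanced P R g) : IsBalanced P R (chainStep P g) := by
  classical
  constructor
  · intro s' hs'
    refine Finset.sum_eq_zero fun s _ => ?_
    by_cases hs : s ∈ R
    · rw [le_antisymm (not_lt.mp fun h => hs' (hR s hs s' h)) (hP.nonneg s s'), mul_zero]
    · rw [hg.support s hs, zero_mul]
  · intro s₀ hs₀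
    rw [massOn_chainStep, ← hg.mass s₀ hs₀, massOn_eq_sum_ite]
    refine Finset.sum_congr rfl fun s _ => ?_
    split_ifs with hs
    · rw [hP.massOn_row_of_mem (C := {s' | ChainReach P s₀ s'})
        (fun a ha b hab => Relation.ReflTransGen.tail ha hab) hs, mul_one]
    · by_cases hsR : s ∈ R
      · rw [massOn, Finset.sum_eq_zero, mul_zero]
        intro c hc
        by_contra hne
        have hedge : ChainReach P s c := .single ((hP.nonneg s c).lt_of_ne' hne)
        have hc' : ChainReach P s₀ c := by simpa using hc
        exact hs (hc'.trans (hrec s hsR c hedge))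
      · rw [hg.support s hsR, zero_mul]

/-- The averages of a balanced vector vanish. -/
theorem stationary_part_eq_zero (hP : IsStochastic P) {R : Set S}
    (hR : ∀ s ∈ R, ∀ s', 0 < P s s' → s' ∈ R)
    (hrec : ∀ s ∈ R, ∀ s', ChainReach P s s' → ChainReach P s' s) {g k w : S → ℝ}
    (hg : IsBalanced P R g) (hk : chainStep P k = k) (hgk : g = k + (w - chainStep P w)) :
    k = 0 := by
  classical
  have hpow : ∀ t, IsBalanced P R ((chainStep P ^ t) g) := by
    intro t
    induction t with
    | zero => simpa using hg
    | succ n ih =>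
      rw [pow_succ', Module.End.mul_apply]
      exact hP.isBalanced_chainStep hR hrec ih
  have hlim := hP.tendsto_average hk hgk
  -- Balance passes from the iterates to their averages and to the limit `k`.
  refine hP.eq_zero_of_massOn_reach_eq_zero hk fun s hs => ?_
  have hsR : s ∈ R := by
    by_contra hsR
    refine hs (tendsto_nhds_unique (hlim s) ?_)
    simp [fun t => (hpow t).support s hsR]
  rw [massOn]
  refine tendsto_nhds_unique (tendsto_finsetSum _ fun s' _ => hlim s') ?_
  have : ∀ n : ℕ, ∑ s' with s' ∈ {s' | ChainReach P s s'},
      (1 / (n : ℝ)) * ∑ t ∈ Finset.Icc 1 n, (chainStep P ^ t) g s' = 0 := by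
    intro n
    rw [← Finset.mul_sum, Finset.sum_comm]
    exact mul_eq_zero_of_right _ (Finset.sum_eq_zero fun t _ => (hpow t).mass s hsR)
  exact tendsto_const_nhds.congr fun n => by convert (this n).symm

end IsStochastic

end Chain

/-! ### Support of the stationary part. -/

section Chain

variable {S : Type*} [Fintype S] {P : S → S → ℝ}

namespace IsStochastic

theorem exists_pow_pos_of_reach (hP : IsStochastic P) {v : S → ℝ} (hv : ∀ s, 0 ≤ v s)
    {s s' : S} (hs : 0 < v s) (h : ChainReach P s s') : ∃ t, 0 < (chainStep P ^ t) v s' := by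
  induction h with
  | refl => exact ⟨0, by simpa using hs⟩
  | tail _ he ih =>
    obtain ⟨t, ht⟩ := ih
    refine ⟨t + 1, ?_⟩
    rw [pow_succ', Module.End.mul_apply]
    exact hP.chainStep_pos (hP.pow_chainStep_nonneg hv t) ht he

theorem exists_reach_of_pow_pos (hP : IsStochastic P) {v : S → ℝ} (t : ℕ) {s : S}
    (hv : ∀ s, 0 ≤ v s) (h : 0 < (chainStep P ^ t) v s) :
    ∃ s₀, 0 < v s₀ ∧ ChainReach P s₀ s := by
  induction t generalizing s with
  | zero => exact ⟨s, by simpa using h, .refl⟩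
  | succ n ih =>
    rw [pow_succ', Module.End.mul_apply, chainStep_apply] at h
    obtain ⟨u, _, hu⟩ := Finset.exists_lt_of_sum_lt (s := Finset.univ) (f := fun _ : S => (0 : ℝ))
      (by simpa using h)
    have hu1 : 0 < (chainStep P ^ n) v u := pos_of_mul_pos_left hu (hP.nonneg u s)
    have hu2 : 0 < P u s := pos_of_mul_pos_right hu (hP.pow_chainStep_nonneg hv n u)
    obtain ⟨s₀, h₀, hr⟩ := ih hu1
    exact ⟨s₀, h₀, hr.tail hu2⟩

theorem massOn_le_massOn_pow (hP : IsStochastic P) {v : S → ℝ} (hv : ∀ s, 0 ≤ v s) {C : Set S}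
    (hC : ∀ s ∈ C, ∀ s', 0 < P s s' → s' ∈ C) (t : ℕ) :
    massOn v C ≤ massOn ((chainStep P ^ t) v) C := by
  classical
  induction t with
  | zero => simp
  | succ n ih =>
    refine ih.trans ?_
    rw [pow_succ', Module.End.mul_apply, massOn_chainStep, massOn_eq_sum_ite]
    refine Finset.sum_le_sum fun s _ => ?_
    split_ifs with hs
    · rw [hP.massOn_row_of_mem hC hs, mul_one]
    · exact mul_nonneg (hP.pow_chainStep_nonneg hv n s) (hP.massOn_row_nonneg C s)

theorem massOn_stationary_part_ge (hP : IsStochastic P) {v k w : S → ℝ} (hv : ∀ s, 0 ≤ v s)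
    (hk : chainStep P k = k) (hvk : v = k + (w - chainStep P w)) {C : Set S}
    (hC : ∀ s ∈ C, ∀ s', 0 < P s s' → s' ∈ C) : massOn v C ≤ massOn k C := by
  classical
  have hlim : Tendsto (fun n : ℕ => ∑ s with s ∈ C,
      (1 / (n : ℝ)) * ∑ t ∈ Finset.Icc 1 n, (chainStep P ^ t) v s) atTop (𝓝 (massOn k C)) := by
    rw [massOn]
    convert tendsto_finsetSum _ fun s _ => hP.tendsto_average hk hvk s
  refine ge_of_tendsto hlim ?_
  filter_upwards [eventually_gt_atTop 0] with n hn
  have hn' : (0 : ℝ) < n := by positivity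
  rw [← Finset.mul_sum, Finset.sum_comm, one_div, le_inv_mul_iff₀ hn']
  have := Finset.card_nsmul_le_sum (Finset.Icc 1 n)
    (fun t => massOn ((chainStep P ^ t) v) C) (massOn v C)
    fun t _ => hP.massOn_le_massOn_pow hv hC t
  rw [Nat.card_Icc, add_tsub_cancel_right, nsmul_eq_mul] at this
  refine this.trans (le_of_eq (Finset.sum_congr rfl fun t _ => ?_))
  rw [massOn]

theorem stationary_part_nonneg (hP : IsStochastic P) {v k w : S → ℝ} (hv : ∀ s, 0 ≤ v s)
    (hk : chainStep P k = k) (hvk : v = k + (w - chainStep P w)) (s : S) : 0 ≤ k s :=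
  ge_of_tendsto' (hP.tendsto_average hk hvk s) fun n => mul_nonneg (by positivity)
    (Finset.sum_nonneg fun t _ => hP.pow_chainStep_nonneg hv t s)

/-- The stationary part of a nonnegative vector is positive exactly at the states of the terminal
strongly connected components. -/
theorem stationary_part_pos_iff (hP : IsStochastic P) {v k w : S → ℝ} (hv : ∀ s, 0 ≤ v s)
    (hk : chainStep P k = k) (hvk : v = k + (w - chainStep P w)) (s : S) :
    0 < k s ↔ s ∈ tsccUnion (fun s s' => 0 < P s s') v := by
  have hk0 := hP.stationary_part_nonneg hv hk hvk
  rw [mem_tsccUnion_iff]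
  constructor
  · intro hs
    refine ⟨?_, fun s' => hP.reach_symm_of_stationary_pos hk hk0 hs⟩
    by_contra hno
    have hzero : ∀ t, (chainStep P ^ t) v s = 0 := fun t =>
      le_antisymm (not_lt.mp fun h => hno (hP.exists_reach_of_pow_pos t hv h))
        (hP.pow_chainStep_nonneg hv t s)
    refine hs.ne' (tendsto_nhds_unique (hP.tendsto_average hk hvk s) ?_)
    simp [hzero]
  · rintro ⟨⟨s₀, h₀, hs₀⟩, hrec⟩
    -- Mass present at `s` at time `t` stays in the closed class of `s`, so `k` is positive
    -- somewhere in it; recurrence carries positivity back to `s`. The iterate at time `t` has the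
    -- same stationary part as `v`.
    obtain ⟨t, ht⟩ := hP.exists_pow_pos_of_reach hv h₀ hs₀
    have hmass := hP.massOn_stationary_part_ge (v := (chainStep P ^ t) v)
      (w := (chainStep P ^ t) w) (hP.pow_chainStep_nonneg hv t) hk
      (by rw [pow_chainStep_eq hk hvk, pow_succ', Module.End.mul_apply])
      (C := {s' | ChainReach P s s'}) (fun a ha b hab => Relation.ReflTransGen.tail ha hab)
    have hpos := massOn_pos (C := {s' | ChainReach P s s'})
      (fun u _ => hP.pow_chainStep_nonneg hv t u) Relation.ReflTransGen.refl ht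
    obtain ⟨u, hu, hku⟩ := exists_pos_of_massOn_pos (hpos.trans_le hmass)
    exact hP.stationary_pos_of_reach hk hk0 hku (hrec u hu)

end IsStochastic

/-- Adding a multiple of a stationary `k` makes a potential nonnegative without altering its
coboundary. In the witness, terms with `k s = 0` are `0`. -/
theorem exists_nonneg_add_mul {z k : S → ℝ} (hk : ∀ s, 0 ≤ k s) (hz : ∀ s, k s = 0 → 0 ≤ z s) :
    ∃ c, ∀ s, 0 ≤ z s + c * k s := by
  refine ⟨∑ s, |z s| / k s, fun s => ?_⟩
  rcases (hk s).eq_or_lt with h | h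
  · rw [← h, mul_zero, add_zero]
    exact hz s h.symm
  · have h1 : |z s| / k s ≤ ∑ s, |z s| / k s :=
      Finset.single_le_sum (f := fun s => |z s| / k s)
        (fun i _ => div_nonneg (abs_nonneg _) (hk i)) (Finset.mem_univ s)
    rw [div_le_iff₀ h] at h1
    have := neg_abs_le (z s)
    linarith

end Chain

/-! ### From edge-preserving policies to feasible points. -/

namespace MDP

variable {S A : Type*} [Fintype S] {M : MDP S A} {π : S → A → ℝ}

theorem IsStationaryPolicy.isStochastic (hπ : M.IsStationaryPolicy π) :
    IsStochastic (M.chainT π) where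
  nonneg s s' := Finset.sum_nonneg fun a ha => mul_nonneg (M.T_nonneg s a ha s') (hπ.nonneg s a)
  sum_eq_one s := by
    simp only [chainT]
    rw [Finset.sum_comm, ← hπ.sum_eq_one s]
    refine Finset.sum_congr rfl fun a ha => ?_
    rw [← Finset.sum_mul, M.T_sum s a ha, one_mul]

theorem stateLaw_eq (M : MDP S A) (π : S → A → ℝ) (t : ℕ) :
    M.stateLaw π t = (chainStep (M.chainT π) ^ t) M.init := by
  induction t with
  | zero => simp [stateLaw]
  | succ n ih =>
    rw [pow_succ', Module.End.mul_apply, ← ih]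
    rfl

theorem sum_mul_T (M : MDP S A) (v : S → ℝ) (π : S → A → ℝ) (s' : S) :
    ∑ s, ∑ a ∈ M.avail s, (v s * π s a) * M.T s a s' = chainStep (M.chainT π) v s' := by
  rw [chainStep_apply]
  refine Finset.sum_congr rfl fun s _ => ?_
  rw [chainT, Finset.mul_sum]
  exact Finset.sum_congr rfl fun a _ => by ring

theorem IsStationaryPolicy.marg_mul (hπ : M.IsStationaryPolicy π) (v : S → ℝ) (s : S) :
    ∑ a ∈ M.avail s, v s * π s a = v s := by
  rw [← Finset.mul_sum, hπ.sum_eq_one, mul_one]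

theorem IsStationaryPolicy.hasOccupationMeasure (hπ : M.IsStationaryPolicy π) {k w : S → ℝ}
    (hk : chainStep (M.chainT π) k = k)
    (hvk : M.init = k + (w - chainStep (M.chainT π) w)) :
    M.HasOccupationMeasure π fun s a => k s * π s a := by
  intro s a
  have := (hπ.isStochastic.tendsto_average hk hvk s).mul_const (π s a)
  refine this.congr fun n => ?_
  rw [mul_assoc, Finset.sum_mul]
  simp only [stateActionLaw, stateLaw_eq]

theorem HasOccupationMeasure.unique {p q : S → A → ℝ} (hp : M.HasOccupationMeasure π p)
    (hq : M.HasOccupationMeasure π q) : p = q := by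
  funext s a
  exact tendsto_nhds_unique (hp s a) (hq s a)

theorem HasOccupationMeasure.avgReward_eq {p : S → A → ℝ} (hp : M.HasOccupationMeasure π p) :
    M.avgReward π = M.objective p := by
  refine Tendsto.liminf_eq ?_
  have := tendsto_finsetSum Finset.univ fun s _ =>
    tendsto_finsetSum (M.avail s) fun a _ => (hp s a).mul_const (M.meanReward s a)
  refine this.congr fun n => ?_
  conv_rhs => rw [Finset.sum_comm, Finset.mul_sum]
  refine Finset.sum_congr rfl fun s _ => ?_
  conv_rhs => rw [Finset.sum_comm, Finset.mul_sum]
  refine Finset.sum_congr rfl fun a _ => ?_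
  rw [← Finset.sum_mul, mul_assoc]

end MDP

namespace LMDP

variable {S A : Type*} [Fintype S] {M : LMDP S A} {π : S → A → ℝ}

/-- The occupation measure of an edge-preserving policy is feasible for the linear program. -/
theorem exists_feasible_of_edgePreserving (hπ : π ∈ M.edgePreserving) (hspec : M.MeetsSpecs π) :
    ∃ ε : ℝ, 0 < ε ∧ ∃ p y : S → A → ℝ, M.HasOccupationMeasure π p ∧ M.LPFeasible ε p y := by
  obtain ⟨hst, hrec, hpos⟩ := hπ
  obtain ⟨p, hp, hsp⟩ := hspec
  have hP := hst.isStochastic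
  obtain ⟨k, z, hk, hkz, hz⟩ := hP.exists_potential M.init_nonneg
  have hk0 := hP.stationary_part_nonneg M.init_nonneg hk hkz
  have hkpos : ∀ s, 0 < k s ↔ s ∈ M.recurrentSet := fun s => by
    rw [← hrec]
    exact hP.stationary_part_pos_iff M.init_nonneg hk hkz s
  have hsumk : ∑ s, k s = 1 := by
    have : ∑ s, M.init s = ∑ s, k s + (∑ s, z s - ∑ s, chainStep (M.chainT π) z s) := by
      rw [← Finset.sum_sub_distrib, ← Finset.sum_add_distrib]
      exact Finset.sum_congr rfl fun s _ => congrFun hkz s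
    rw [M.init_sum, hP.sum_chainStep] at this
    linarith
  obtain ⟨c, hc⟩ := exists_nonneg_add_mul hk0 hz
  obtain rfl := hp.unique (hst.hasOccupationMeasure hk hkz)
  obtain ⟨ε, hε, hle⟩ : ∃ ε : ℝ, 0 < ε ∧
      ∀ s ∈ M.recurrentSet, ∀ a ∈ M.avail s, ε ≤ k s * π s a := by
    classical
    have h : ∀ s, ∃ ε : ℝ, 0 < ε ∧ (s ∈ M.recurrentSet → ∀ a ∈ M.avail s, ε ≤ k s * π s a) := by
      intro s
      by_cases hs : s ∈ M.recurrentSet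
      · refine ⟨(M.avail s).inf' (M.avail_nonempty s) fun a => k s * π s a, ?_, fun _ a ha =>
          Finset.inf'_le _ ha⟩
        rw [Finset.lt_inf'_iff]
        exact fun a ha => mul_pos ((hkpos s).2 hs) (hpos s hs a ha)
      · exact ⟨1, one_pos, fun h => absurd h hs⟩
    choose e he hle using h
    have hne : (Finset.univ : Finset S).Nonempty := by
      by_contra hne
      have := M.init_sum
      rw [Finset.not_nonempty_iff_eq_empty.mp hne] at this
      simp at this
    refine ⟨Finset.univ.inf' hne e, (Finset.lt_inf'_iff _).2 fun s _ => he s, fun s hs a ha => ?_⟩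
    exact (Finset.inf'_le _ (Finset.mem_univ s)).trans (hle s hs a ha)
  -- With `y` the shifted potential spread by `π`, the flow constraint is the splitting `hkz` of the
  -- initial distribution.
  refine ⟨ε, hε, _, fun s a => (z s + c * k s) * π s a, hp, ⟨?_, ?_, ?_, ?_, ?_⟩, hsp, hle⟩
  · intro s'
    rw [M.sum_mul_T, hk, hst.marg_mul]
  · intro s'
    rw [M.sum_mul_T (fun s => z s + c * k s), Finset.sum_add_distrib, hst.marg_mul,
      hst.marg_mul (fun s => z s + c * k s)]
    have h1 : chainStep (M.chainT π) (fun s => z s + c * k s)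
        = chainStep (M.chainT π) z + c • k := by
      conv_rhs => rw [← hk, ← map_smul, ← map_add]
      rfl
    have h2 := congrFun hkz s'
    simp only [Pi.add_apply, Pi.sub_apply] at h2
    rw [h1]
    simp only [Pi.add_apply, Pi.smul_apply, smul_eq_mul]
    linarith
  · refine Finset.sum_eq_zero fun s hs => ?_
    rw [hst.marg_mul]
    have hs' : s ∉ M.recurrentSet := by simpa using hs
    exact le_antisymm (not_lt.mp fun h => hs' ((hkpos s).1 h)) (hk0 s)
  · intro s a ha
    refine ⟨mul_nonneg (hk0 s) (hst.nonneg s a), mul_le_one₀ ?_ (hst.nonneg s a) ?_⟩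
    · rw [← hsumk]
      exact Finset.single_le_sum (fun i _ => hk0 i) (Finset.mem_univ s)
    · rw [← hst.sum_eq_one s]
      exact Finset.single_le_sum (f := π s) (fun i _ => hst.nonneg s i) ha
  · exact fun s a _ => mul_nonneg (hc s) (hst.nonneg s a)

end LMDP

/-! ### Flows absorbed by recurrent classes. -/

section Flow

variable {S : Type*} [Fintype S]

/-- A flow `W` with node values `Y`, sources `β` and sinks `X` on a set `R` of recurrent states
of the chain `P`; outside `R` the flow is driven by `P`. -/
structure IsAbsorbingFlow (P W : S → S → ℝ) (X Y β : S → ℝ) (R : Set S) : Prop where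
  stochastic : IsStochastic P
  flow_nonneg : ∀ s s', 0 ≤ W s s'
  row : ∀ s, ∑ s', W s s' = Y s
  off : ∀ s, s ∉ R → ∀ s', W s s' = Y s * P s s'
  edge : ∀ s s', 0 < W s s' → 0 < P s s'
  balance : ∀ s', ∑ s, W s s' = X s' + Y s' - β s'
  sink_off : ∀ s, s ∉ R → X s = 0
  sink_on : ∀ s ∈ R, 0 < X s
  source_nonneg : ∀ s, 0 ≤ β s
  closed : ∀ s ∈ R, ∀ s', ChainReach P s s' → s' ∈ R
  recurrent : ∀ s ∈ R, ∀ s', ChainReach P s s' → ChainReach P s' s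

namespace IsAbsorbingFlow

variable {P W : S → S → ℝ} {X Y β : S → ℝ} {R : Set S}

theorem flow_eq_zero (h : IsAbsorbingFlow P W X Y β R) {s s' : S} (hP : ¬ 0 < P s s') :
    W s s' = 0 :=
  le_antisymm (not_lt.mp fun hW => hP (h.edge s s' hW)) (h.flow_nonneg s s')

theorem sum_massOn (h : IsAbsorbingFlow P W X Y β R) (C : Set S) :
    ∑ s, massOn (W s) C = massOn X C + massOn Y C - massOn β C := by
  simp only [massOn]
  rw [Finset.sum_comm, ← Finset.sum_add_distrib, ← Finset.sum_sub_distrib]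
  exact Finset.sum_congr rfl fun s _ => h.balance s

theorem massOn_row_of_mem (h : IsAbsorbingFlow P W X Y β R) {C : Set S}
    (hC : ∀ s ∈ C, ∀ s', 0 < P s s' → s' ∈ C) {s : S} (hs : s ∈ C) : massOn (W s) C = Y s := by
  rw [massOn_eq_sum, h.row]
  exact fun s' hs' => h.flow_eq_zero fun hP => hs' (hC s hs s' hP)

open Classical in
/-- The flow into a closed set. -/
theorem sum_massOn_outside (h : IsAbsorbingFlow P W X Y β R) {C : Set S}
    (hC : ∀ s ∈ C, ∀ s', 0 < P s s' → s' ∈ C) :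
    ∑ s, (if s ∈ C then 0 else massOn (W s) C) = massOn X C - massOn β C := by
  have h1 := h.sum_massOn C
  have h2 : massOn Y C = ∑ s, if s ∈ C then massOn (W s) C else 0 := by
    rw [massOn_eq_sum_ite]
    refine Finset.sum_congr rfl fun s _ => ?_
    split_ifs with hs
    · exact (h.massOn_row_of_mem hC hs).symm
    · rfl
  have h3 : ∑ s, massOn (W s) C = ∑ s, (if s ∈ C then 0 else massOn (W s) C) +
      ∑ s, if s ∈ C then massOn (W s) C else 0 := by
    rw [← Finset.sum_add_distrib]
    refine Finset.sum_congr rfl fun s _ => ?_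
    split_ifs <;> simp
  linarith

theorem mem_of_mem_tsccUnion (h : IsAbsorbingFlow P W X Y β R) {s : S}
    (hs : s ∈ tsccUnion (fun s s' => 0 < P s s') β) : s ∈ R := by
  classical
  obtain ⟨⟨s₀, h₀, hs₀⟩, hrec⟩ := (mem_tsccUnion_iff _ _ _).1 hs
  by_contra hsR
  have hout : ∀ u, ChainReach P u s → u ∉ R := fun u hu huR => hsR (h.closed u huR s hu)
  -- A terminal class `D` outside `R` has no sinks, hence neither sources nor inflow. Yet along a
  -- path from a source to `s`, which avoids `R`, the node values stay positive and every edge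
  -- carries flow, so flow would enter `D`.
  set D : Set S := {u | ChainReach P s u} with hD
  have hDR : ∀ u ∈ D, u ∉ R := fun u hu => hout u (hrec u hu)
  have hDcl : ∀ u ∈ D, ∀ v, 0 < P u v → v ∈ D := fun u hu v huv =>
    Relation.ReflTransGen.tail hu huv
  have hsum := h.sum_massOn_outside hDcl
  have hX : massOn X D = 0 := massOn_eq_zero fun u hu => h.sink_off u (hDR u hu)
  have hβ := massOn_nonneg (C := D) fun u _ => h.source_nonneg u
  have hterm : ∀ u, 0 ≤ if u ∈ D then 0 else massOn (W u) D := fun u => by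
    split_ifs
    · exact le_rfl
    · exact massOn_nonneg fun v _ => h.flow_nonneg u v
  have hβ0 : massOn β D = 0 := by
    have := Finset.sum_nonneg fun u (_ : u ∈ Finset.univ) => hterm u
    linarith
  have hin : ∀ b c, 0 < W b c → c ∈ D → b ∈ D := by
    intro b c hbc hc
    by_contra hb
    have h0 : ∑ u, (if u ∈ D then 0 else massOn (W u) D) = 0 := by rw [hsum, hX, hβ0, sub_zero]
    have := (Finset.sum_eq_zero_iff_of_nonneg fun u _ => hterm u).1 h0 b (Finset.mem_univ b)
    rw [if_neg hb] at this
    exact (massOn_pos (fun v _ => h.flow_nonneg b v) hc hbc).ne' this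
  have key : ∀ u, ChainReach P s₀ u → ChainReach P u s → 0 < Y u ∧ u ∉ D := by
    intro u hu
    induction hu with
    | refl =>
      intro hr
      refine ⟨?_, fun hmem => (massOn_pos (fun v _ => h.source_nonneg v) hmem h₀).ne' hβ0⟩
      have h1 := h.balance s₀
      rw [h.sink_off s₀ (hout s₀ hr)] at h1
      have := Finset.sum_nonneg fun v (_ : v ∈ Finset.univ) => h.flow_nonneg v s₀
      linarith
    | @tail b c _ hbc ih =>
      intro hr
      have hrb : ChainReach P b s := Relation.ReflTransGen.head hbc hr
      obtain ⟨hYb, hbD⟩ := ih hrb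
      have hW : 0 < W b c := by
        rw [h.off b (hout b hrb)]
        exact mul_pos hYb hbc
      refine ⟨?_, fun hc => hbD (hin b c hW hc)⟩
      have h1 := h.balance c
      rw [h.sink_off c (hout c hr)] at h1
      have := Finset.single_le_sum (f := fun v => W v c) (fun v _ => h.flow_nonneg v c)
        (Finset.mem_univ b)
      have := h.source_nonneg c
      linarith
  exact (key s hs₀ .refl).2 .refl

theorem exists_source_reach (h : IsAbsorbingFlow P W X Y β R) {s : S} (hs : s ∈ R) :
    ∃ s₀, 0 < β s₀ ∧ ChainReach P s₀ s := by
  classical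
  by_contra! hno
  have hβ : ∀ u, ChainReach P u s → β u = 0 := fun u hu =>
    le_antisymm (not_lt.mp fun hpos => hno u hpos hu) (h.source_nonneg u)
  -- The class `C` has sinks but no sources, so flow enters it from some `s₁` outside `R`.
  set C : Set S := {u | ChainReach P s u} with hC
  have hCcl : ∀ u ∈ C, ∀ v, 0 < P u v → v ∈ C := fun u hu v huv =>
    Relation.ReflTransGen.tail hu huv
  have hsum := h.sum_massOn_outside hCcl
  have hβ0 : massOn β C = 0 := massOn_eq_zero fun u hu => hβ u (h.recurrent s hs u hu)
  have hX : 0 < massOn X C :=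
    massOn_pos (fun u hu => (h.sink_on u (h.closed s hs u hu)).le) (s := s)
      Relation.ReflTransGen.refl (h.sink_on s hs)
  obtain ⟨s₁, _, h₁⟩ := Finset.exists_lt_of_sum_lt (s := Finset.univ) (f := fun _ : S => (0 : ℝ))
    (g := fun u => if u ∈ C then 0 else massOn (W u) C) (by
      rw [hsum, hβ0, sub_zero]
      simpa using hX)
  have hs₁C : s₁ ∉ C := fun hmem => by simp [hmem] at h₁
  rw [if_neg hs₁C] at h₁
  obtain ⟨c, hc, hW⟩ := exists_pos_of_massOn_pos h₁
  have hPc := h.edge s₁ c hW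
  have hcs : ChainReach P c s := h.recurrent s hs c hc
  have hcR : c ∈ R := h.closed s hs c hc
  have hs₁R : s₁ ∉ R := fun hR =>
    hs₁C (Relation.ReflTransGen.trans hc (h.recurrent s₁ hR c (.single hPc)))
  -- `V` has no sources or sinks and only predecessors in `V`, so its inflow and outflow should
  -- agree; but it leaks through the edge from `s₁` to `c`.
  set V : Set S := {u | u ∉ R ∧ ∀ s₀, 0 < β s₀ → ¬ ChainReach P s₀ u} with hV
  have hs₁V : s₁ ∈ V := ⟨hs₁R, fun s₀ h₀ hr => hno s₀ h₀ ((hr.tail hPc).trans hcs)⟩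
  have hbal := h.sum_massOn V
  have hXV : massOn X V = 0 := massOn_eq_zero fun u hu => h.sink_off u hu.1
  have hβV : massOn β V = 0 := massOn_eq_zero fun u hu =>
    le_antisymm (not_lt.mp fun hpos => hu.2 u hpos .refl) (h.source_nonneg u)
  rw [hXV, hβV, zero_add, sub_zero, massOn_eq_sum_ite Y] at hbal
  have hle : ∀ u, massOn (W u) V ≤ Y u := fun u =>
    h.row u ▸ massOn_le_sum (h.flow_nonneg u) V
  refine hbal.not_lt (Finset.sum_lt_sum (fun u _ => ?_) ⟨s₁, Finset.mem_univ _, ?_⟩)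
  · split_ifs with hu
    · exact hle u
    · refine le_of_eq (Finset.sum_eq_zero fun v hv => h.flow_eq_zero fun hP => hu ?_)
      have hv' : v ∈ V := by simpa using hv
      exact ⟨fun huR => hv'.1 (h.closed u huR v (.single hP)),
        fun s₀ h₀ hr => hv'.2 s₀ h₀ (hr.tail hP)⟩
  · rw [if_pos hs₁V, ← h.row s₁]
    exact massOn_lt_sum (h.flow_nonneg s₁) (fun hc => hc.1 hcR) hW

theorem tsccUnion_eq (h : IsAbsorbingFlow P W X Y β R) :
    tsccUnion (fun s s' => 0 < P s s') β = R :=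
  Set.Subset.antisymm (fun _ hs => h.mem_of_mem_tsccUnion hs) fun s hs =>
    (mem_tsccUnion_iff _ _ _).2 ⟨h.exists_source_reach hs, h.recurrent s hs⟩

/-- A stationary vector of sinks is the stationary part of the sources. -/
theorem exists_potential (h : IsAbsorbingFlow P W X Y β R) (hX : chainStep P X = X) :
    ∃ w, β = X + (w - chainStep P w) := by
  classical
  have hP := h.stochastic
  obtain ⟨k, w, hk, hkw⟩ := hP.exists_decomposition β
  -- Off `R` the flow is driven by `P`, so `β - X` minus the coboundary of `q` vanishes there.
  -- Conservation gives it mass zero on each class. Its stationary part `k - X` is therefore zero.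
  set q : S → ℝ := fun s => if s ∈ R then 0 else Y s with hq
  have hqW : ∀ s s', q s * P s s' = if s ∈ R then 0 else W s s' := fun s s' => by
    simp only [hq]
    split_ifs with hs
    · exact zero_mul _
    · exact (h.off s hs s').symm
  have hg : IsBalanced P R (β - X - (q - chainStep P q)) := by
    constructor
    · intro s' hs'
      have h1 : chainStep P q s' = ∑ s, W s s' := by
        rw [chainStep_apply]
        refine Finset.sum_congr rfl fun s _ => ?_
        rw [hqW]
        split_ifs with hs
        · exact (h.flow_eq_zero fun hpos => hs' (h.closed s hs s' (.single hpos))).symm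
        · rfl
      have h2 : q s' = Y s' := if_neg hs'
      rw [Pi.sub_apply, Pi.sub_apply, Pi.sub_apply, h1, h.balance, h2]
      ring
    · intro s hs
      have hcl : ∀ u ∈ {s' | ChainReach P s s'}, ∀ v, 0 < P u v → v ∈ {s' | ChainReach P s s'} :=
        fun u hu v huv => Relation.ReflTransGen.tail hu huv
      have h1 := h.sum_massOn_outside hcl
      have h2 : massOn q {s' | ChainReach P s s'} = 0 :=
        massOn_eq_zero fun u hu => if_pos (h.closed s hs u hu)
      have h3 : massOn (chainStep P q) {s' | ChainReach P s s'}
          = ∑ u, if u ∈ {s' | ChainReach P s s'} then 0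
            else massOn (W u) {s' | ChainReach P s s'} := by
        rw [massOn_chainStep]
        refine Finset.sum_congr rfl fun u _ => ?_
        rw [massOn, Finset.mul_sum]
        simp only [hqW]
        split_ifs with hu huC huC
        · simp
        · symm
          simp only [Finset.sum_const_zero]
          refine Finset.sum_eq_zero fun v hv => h.flow_eq_zero fun hpos => huC ?_
          have hv' : ChainReach P s v := by simpa using hv
          exact hv'.trans (h.recurrent u hu v (.single hpos))
        · exact absurd (h.closed s hs u huC) hu
        · rfl
      rw [massOn_sub, massOn_sub, massOn_sub, h2, h3, h1]
      ring
  have hkX := hP.stationary_part_eq_zero (fun s hs s' hpos => h.closed s hs s' (.single hpos))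
    h.recurrent hg (k := k - X) (w := w - q) (by rw [map_sub, hk, hX]) (by
      rw [map_sub]
      nth_rewrite 1 [hkw]
      abel)
  rw [sub_eq_zero] at hkX
  exact ⟨w, hkX ▸ hkw⟩

end IsAbsorbingFlow

end Flow

/-! ### From feasible points to edge-preserving policies. -/

namespace MDP

variable {S A : Type*} [Fintype S] {M : MDP S A} {x y π : S → A → ℝ}

theorem edge_of_chainT_pos (hπ : M.IsStationaryPolicy π) {s s' : S} (h : 0 < M.chainT π s s') :
    M.Edge s s' := by
  obtain ⟨a, ha, hpos⟩ := Finset.exists_lt_of_sum_lt (f := fun _ : A => (0 : ℝ))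
    (by simpa [chainT] using h)
  exact ⟨a, ha, pos_of_mul_pos_left hpos (hπ.nonneg s a)⟩

theorem chainT_pos (hπ : M.IsStationaryPolicy π) {s s' : S} {a : A} (ha : a ∈ M.avail s)
    (hT : 0 < M.T s a s') (hpos : 0 < π s a) : 0 < M.chainT π s s' :=
  Finset.sum_pos' (fun b hb => mul_nonneg (M.T_nonneg s b hb s') (hπ.nonneg s b))
    ⟨a, ha, mul_pos hT hpos⟩

theorem reflTransGen_edge_of_chainReach (hπ : M.IsStationaryPolicy π) {s s' : S}
    (h : ChainReach (M.chainT π) s s') : Relation.ReflTransGen M.Edge s s' :=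
  Relation.ReflTransGen.mono (fun _ _ => edge_of_chainT_pos hπ) _ _ h

theorem chainReach_of_mem_recurrentSet (hπ : M.IsStationaryPolicy π)
    (hpos : ∀ s ∈ M.recurrentSet, ∀ a ∈ M.avail s, 0 < π s a) {s s' : S}
    (hs : s ∈ M.recurrentSet) (h : Relation.ReflTransGen M.Edge s s') :
    ChainReach (M.chainT π) s s' := by
  induction h with
  | refl => exact .refl
  | tail hb hbc ih =>
    obtain ⟨a, ha, hT⟩ := hbc
    exact ih.tail (chainT_pos hπ ha hT (hpos _ (mem_tsccUnion_of_reflTransGen hs hb) a ha))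

namespace MemQ0

theorem marg_x_nonneg (h : M.MemQ0 x y) (s : S) : 0 ≤ M.marg x s :=
  Finset.sum_nonneg fun a ha => (h.x_mem s a ha).1

theorem marg_y_nonneg (h : M.MemQ0 x y) (s : S) : 0 ≤ M.marg y s :=
  Finset.sum_nonneg fun a ha => h.y_nonneg s a ha

theorem marg_x_eq_zero (h : M.MemQ0 x y) {s : S} (hs : s ∉ M.recurrentSet) :
    M.marg x s = 0 := by
  classical
  have h1 : ∑ f with f ∉ M.recurrentSet, M.marg x f = 0 := by
    simp only [MDP.marg]
    convert h.transient
  exact (Finset.sum_eq_zero_iff_of_nonneg fun f _ => h.marg_x_nonneg f).1 h1 s (by simpa using hs)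

theorem marg_x_pos (hlow : ∀ s ∈ M.recurrentSet, ∀ a ∈ M.avail s, 0 < x s a) {s : S}
    (hs : s ∈ M.recurrentSet) : 0 < M.marg x s :=
  Finset.sum_pos (fun a ha => hlow s hs a ha) (M.avail_nonempty s)

theorem x_eq (h : M.MemQ0 x y) (hi : M.IsInducedPolicy x y π) {s : S} {a : A}
    (ha : a ∈ M.avail s) : x s a = M.marg x s * π s a := by
  rcases (h.marg_x_nonneg s).eq_or_lt with h0 | hpos
  · rw [← h0, zero_mul]
    exact (Finset.sum_eq_zero_iff_of_nonneg fun a ha => (h.x_mem s a ha).1).1 h0.symm a ha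
  · rw [hi.of_x s hpos a ha, mul_div_cancel₀ _ hpos.ne']

/-- On the recurrent set the policy is read off from `x`, so this factorisation of `y` is only
available outside it. -/
theorem y_eq (h : M.MemQ0 x y) (hi : M.IsInducedPolicy x y π) {s : S} {a : A}
    (ha : a ∈ M.avail s) (hs : s ∉ M.recurrentSet) : y s a = M.marg y s * π s a := by
  rcases (h.marg_y_nonneg s).eq_or_lt with h0 | hpos
  · rw [← h0, zero_mul]
    exact (Finset.sum_eq_zero_iff_of_nonneg fun a ha => h.y_nonneg s a ha).1 h0.symm a ha
  · rw [hi.of_y s (h.marg_x_eq_zero hs).not_gt hpos a ha, mul_div_cancel₀ _ hpos.ne']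

theorem policy_pos (hi : M.IsInducedPolicy x y π)
    (hlow : ∀ s ∈ M.recurrentSet, ∀ a ∈ M.avail s, 0 < x s a) :
    ∀ s ∈ M.recurrentSet, ∀ a ∈ M.avail s, 0 < π s a := by
  intro s hs a ha
  rw [hi.of_x s (marg_x_pos hlow hs) a ha]
  exact div_pos (hlow s hs a ha) (marg_x_pos hlow hs)

theorem chainStep_marg_x (h : M.MemQ0 x y) (hi : M.IsInducedPolicy x y π) :
    chainStep (M.chainT π) (M.marg x) = M.marg x := by
  funext s'
  rw [← M.sum_mul_T, marg, ← h.stationary s']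
  exact Finset.sum_congr rfl fun s _ => Finset.sum_congr rfl fun a ha => by rw [h.x_eq hi ha]

/-- The flow of `y` along the edges of the transition graph is absorbed by `x`. -/
theorem isAbsorbingFlow (h : M.MemQ0 x y) (hi : M.IsInducedPolicy x y π)
    (hlow : ∀ s ∈ M.recurrentSet, ∀ a ∈ M.avail s, 0 < x s a) :
    IsAbsorbingFlow (M.chainT π) (fun s s' => ∑ a ∈ M.avail s, y s a * M.T s a s') (M.marg x)
      (M.marg y) M.init M.recurrentSet where
  stochastic := hi.stationary.isStochastic
  flow_nonneg s s' := Finset.sum_nonneg fun a ha =>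
    mul_nonneg (h.y_nonneg s a ha) (M.T_nonneg s a ha s')
  row s := by
    rw [Finset.sum_comm, marg]
    refine Finset.sum_congr rfl fun a ha => ?_
    rw [← Finset.mul_sum, M.T_sum s a ha, mul_one]
  off s hs s' := by
    rw [chainT, Finset.mul_sum]
    refine Finset.sum_congr rfl fun a ha => ?_
    rw [h.y_eq hi ha hs]
    ring
  edge s s' hpos := by
    obtain ⟨a, ha, ha'⟩ := Finset.exists_lt_of_sum_lt (f := fun _ : A => (0 : ℝ))
      (by simpa using hpos)
    have hT : 0 < M.T s a s' := pos_of_mul_pos_right ha' (h.y_nonneg s a ha)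
    have hy : 0 < y s a := pos_of_mul_pos_left ha' (M.T_nonneg s a ha s')
    refine chainT_pos hi.stationary ha hT ?_
    by_cases hs : s ∈ M.recurrentSet
    · exact policy_pos hi hlow s hs a ha
    · rw [h.y_eq hi ha hs] at hy
      exact pos_of_mul_pos_right hy (h.marg_y_nonneg s)
  balance s' := by
    rw [h.flow s', Finset.sum_add_distrib]
    rfl
  sink_off _ hs := h.marg_x_eq_zero hs
  sink_on _ hs := marg_x_pos hlow hs
  source_nonneg := M.init_nonneg
  closed _ hs _ hr :=
    mem_tsccUnion_of_reflTransGen hs (reflTransGen_edge_of_chainReach hi.stationary hr)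
  recurrent s hs s' hr := by
    have hr' := reflTransGen_edge_of_chainReach hi.stationary hr
    exact chainReach_of_mem_recurrentSet hi.stationary (policy_pos hi hlow)
      (mem_tsccUnion_of_reflTransGen hs hr') (((mem_tsccUnion_iff _ _ _).1 hs).2 s' hr')

theorem mem_edgePreserving (h : M.MemQ0 x y) (hi : M.IsInducedPolicy x y π)
    (hlow : ∀ s ∈ M.recurrentSet, ∀ a ∈ M.avail s, 0 < x s a) : π ∈ M.edgePreserving :=
  ⟨hi.stationary, (h.isAbsorbingFlow hi hlow).tsccUnion_eq, policy_pos hi hlow⟩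

theorem hasOccupationMeasure (h : M.MemQ0 x y) (hi : M.IsInducedPolicy x y π)
    (hlow : ∀ s ∈ M.recurrentSet, ∀ a ∈ M.avail s, 0 < x s a) :
    M.HasOccupationMeasure π fun s a => M.marg x s * π s a := by
  obtain ⟨w, hw⟩ := (h.isAbsorbingFlow hi hlow).exists_potential (h.chainStep_marg_x hi)
  exact hi.stationary.hasOccupationMeasure (h.chainStep_marg_x hi) hw

end MemQ0

end MDP

namespace LMDP

variable {S A : Type*} [Fintype S] {M : LMDP S A} {x y π : S → A → ℝ} {ε : ℝ}

namespace LPFeasible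

theorem x_pos (h : M.LPFeasible ε x y) (hε : 0 < ε) :
    ∀ s ∈ M.recurrentSet, ∀ a ∈ M.avail s, 0 < x s a :=
  fun s hs a ha => hε.trans_le (h.lower s hs a ha)

theorem mono (h : M.LPFeasible ε x y) {ε' : ℝ} (hε : ε' ≤ ε) : M.LPFeasible ε' x y :=
  ⟨h.memQ0, h.specs, fun s hs a ha => hε.trans (h.lower s hs a ha)⟩

theorem mem_edgePreserving (h : M.LPFeasible ε x y) (hε : 0 < ε)
    (hi : M.IsInducedPolicy x y π) : π ∈ M.edgePreserving :=
  h.memQ0.mem_edgePreserving hi (h.x_pos hε)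

theorem meetsSpecs (h : M.LPFeasible ε x y) (hε : 0 < ε) (hi : M.IsInducedPolicy x y π) :
    M.MeetsSpecs π := by
  refine ⟨_, h.memQ0.hasOccupationMeasure hi (h.x_pos hε), fun i => ?_⟩
  have heq : ∑ s ∈ M.label i, ∑ a ∈ M.avail s, M.marg x s * π s a =
      ∑ s ∈ M.label i, ∑ a ∈ M.avail s, x s a :=
    Finset.sum_congr rfl fun s _ => Finset.sum_congr rfl fun a ha => (h.memQ0.x_eq hi ha).symm
  rw [heq]
  exact h.specs i

theorem avgReward_eq (h : M.LPFeasible ε x y) (hε : 0 < ε) (hi : M.IsInducedPolicy x y π) :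
    M.avgReward π = M.objective x := by
  rw [(h.memQ0.hasOccupationMeasure hi (h.x_pos hε)).avgReward_eq]
  exact Finset.sum_congr rfl fun s _ => Finset.sum_congr rfl fun a ha => by
    rw [h.memQ0.x_eq hi ha]

theorem objective_le (h : M.LPFeasible ε x y) :
    M.objective x ≤ ∑ s, ∑ a ∈ M.avail s, |M.meanReward s a| := by
  refine Finset.sum_le_sum fun s _ => Finset.sum_le_sum fun a ha => ?_
  obtain ⟨h0, h1⟩ := h.memQ0.x_mem s a ha
  exact (mul_le_mul_of_nonneg_left (le_abs_self _) h0).trans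
    (mul_le_of_le_one_left (abs_nonneg _) h1)

end LPFeasible

end LMDP

/-! ### Bounded nonnegative preimages under a linear map. -/

section NonnegPreimage

variable {ι κ : Type*} [Fintype ι]

/-- Every nonnegative vector can be replaced by one with the same image under a linear map, on
whose support the map is injective. -/
theorem exists_nonneg_injOn_support (L : (ι → ℝ) →ₗ[ℝ] (κ → ℝ)) (y : ι → ℝ)
    (hy : ∀ i, 0 ≤ y i) :
    ∃ y', (∀ i, 0 ≤ y' i) ∧ L y' = L y ∧
      ∀ d : ι → ℝ, (∀ i, y' i = 0 → d i = 0) → L d = 0 → d = 0 := by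
  classical
  induction hn : (Finset.univ.filter fun i => y i ≠ 0).card using Nat.strong_induction_on
    generalizing y with
  | _ n ih =>
    by_cases hinj : ∀ d : ι → ℝ, (∀ i, y i = 0 → d i = 0) → L d = 0 → d = 0
    · exact ⟨y, hy, rfl, hinj⟩
    push Not at hinj
    obtain ⟨d, hd, hLd, hd0⟩ := hinj
    obtain ⟨d, hd, hLd, j, hj⟩ : ∃ d : ι → ℝ, (∀ i, y i = 0 → d i = 0) ∧ L d = 0 ∧
        ∃ j, 0 < d j := by
      obtain ⟨j, hj⟩ := Function.ne_iff.1 hd0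
      rcases lt_or_gt_of_ne hj with h | h
      · exact ⟨-d, fun i hi => by simp [hd i hi], by simp [hLd], j, by simpa using h⟩
      · exact ⟨d, hd, hLd, j, h⟩
    -- Ratio test of the simplex method: moving along the kernel direction `-d` until a first
    -- coordinate `m` hits zero keeps nonnegativity and shrinks the support.
    obtain ⟨m, hm, hmin⟩ := Finset.exists_min_image (Finset.univ.filter fun i => 0 < d i)
      (fun i => y i / d i) ⟨j, by simpa using hj⟩
    have hdm : 0 < d m := by simpa using hm
    set t := y m / d m with ht
    have ht0 : 0 ≤ t := div_nonneg (hy m) hdm.le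
    have hy' : ∀ i, 0 ≤ (y - t • d) i := fun i => by
      simp only [Pi.sub_apply, Pi.smul_apply, smul_eq_mul, sub_nonneg]
      by_cases hi : 0 < d i
      · rw [← le_div_iff₀ hi]
        exact hmin i (by simpa using hi)
      · exact (mul_nonpos_of_nonneg_of_nonpos ht0 (not_lt.mp hi)).trans (hy i)
    have hLy : L (y - t • d) = L y := by simp [hLd]
    obtain ⟨y', h0, hL, hI⟩ := ih _ (by
      rw [← hn]
      refine Finset.card_lt_card ((Finset.ssubset_iff_of_subset fun i hi => ?_).2 ⟨m, ?_, ?_⟩)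
      · simp only [Finset.mem_filter, Finset.mem_univ, true_and] at hi ⊢
        exact fun h => hi (by simp [h, hd i h])
      · simp only [Finset.mem_filter, Finset.mem_univ, true_and]
        exact fun h => hdm.ne' (hd m h)
      · simp [ht, hdm.ne']) (y - t • d) hy' rfl
    exact ⟨y', h0, hL.trans hLy, hI⟩

/-- The constant is placed before the injectivity hypothesis so that one can be chosen for every
support `I`; the finitely many choices are later summed into a uniform bound. -/
theorem exists_norm_bound_of_injOn [Fintype κ] (L : (ι → ℝ) →ₗ[ℝ] (κ → ℝ)) (I : Set ι) :
    ∃ K : ℝ, 0 ≤ K ∧ ((∀ d : ι → ℝ, (∀ i ∉ I, d i = 0) → L d = 0 → d = 0) →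
      ∀ d : ι → ℝ, (∀ i ∉ I, d i = 0) → ‖d‖ ≤ K * ‖L d‖) := by
  by_cases hinj : ∀ d : ι → ℝ, (∀ i ∉ I, d i = 0) → L d = 0 → d = 0
  · let V : Submodule ℝ (ι → ℝ) :=
      { carrier := {d | ∀ i ∉ I, d i = 0}
        add_mem' := fun ha hb i hi => by simp [ha i hi, hb i hi]
        zero_mem' := fun _ _ => rfl
        smul_mem' := fun c d hd i hi => by simp [hd i hi] }
    have hker : LinearMap.ker (L.domRestrict V) = ⊥ := by
      rw [LinearMap.ker_eq_bot']
      rintro ⟨d, hd⟩ h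
      exact Subtype.ext (hinj d hd h)
    obtain ⟨K, -, hK⟩ := LinearMap.exists_antilipschitzWith _ hker
    refine ⟨K, K.2, fun _ d hd => ?_⟩
    have := hK.le_mul_norm_sub ⟨d, hd⟩ 0
    simpa using this
  · exact ⟨0, le_rfl, fun h => absurd h hinj⟩

/-- Nonnegative preimages under a linear map can be chosen of bounded size. -/
theorem exists_bounded_nonneg_preimage [Fintype κ] (L : (ι → ℝ) →ₗ[ℝ] (κ → ℝ)) :
    ∃ K : ℝ, 0 ≤ K ∧ ∀ y : ι → ℝ, (∀ i, 0 ≤ y i) →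
      ∃ y', (∀ i, 0 ≤ y' i) ∧ L y' = L y ∧ ‖y'‖ ≤ K * ‖L y‖ := by
  classical
  choose K hK0 hK using exists_norm_bound_of_injOn L
  refine ⟨∑ I, K I, Finset.sum_nonneg fun I _ => hK0 I, fun y hy => ?_⟩
  obtain ⟨y', h0, hL, hI⟩ := exists_nonneg_injOn_support L y hy
  refine ⟨y', h0, hL, ?_⟩
  have h := hK {i | y' i ≠ 0} (fun d hd => hI d fun i hi => hd i (by simpa using hi)) y'
    (fun i hi => by simpa using hi)
  rw [hL] at h
  exact h.trans (mul_le_mul_of_nonneg_right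
    (Finset.single_le_sum (fun I _ => hK0 I) (Finset.mem_univ _)) (norm_nonneg _))

end NonnegPreimage

/-! ### Existence of optimal solutions. -/

namespace MDP

variable {S A : Type*} [Fintype S]

/-- The net outflow of action values, as a linear map. -/
def flowMap (M : MDP S A) : ((Σ s : S, M.avail s) → ℝ) →ₗ[ℝ] (S → ℝ) where
  toFun y := fun s' => ∑ s, ∑ a : M.avail s, y ⟨s, a⟩ * M.T s a s' - ∑ a : M.avail s', y ⟨s', a⟩
  map_add' y z := by
    funext s'
    simp only [Pi.add_apply, add_mul, Finset.sum_add_distrib]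
    ring
  map_smul' c y := by
    funext s'
    simp only [Pi.smul_apply, smul_eq_mul, mul_assoc, RingHom.id_apply, ← Finset.mul_sum]
    ring

theorem flowMap_restrict (M : MDP S A) (y : S → A → ℝ) (s' : S) :
    M.flowMap (fun i => y i.1 i.2) s' =
      ∑ s, ∑ a ∈ M.avail s, y s a * M.T s a s' - ∑ a ∈ M.avail s', y s' a := by
  change ∑ s, ∑ a : M.avail s, y s a * M.T s a s' - ∑ a : M.avail s', y s' a = _
  rw [Finset.sum_coe_sort (M.avail s') (y s')]
  congr 1
  exact Finset.sum_congr rfl fun s _ =>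
    Finset.sum_coe_sort (M.avail s) fun a => y s a * M.T s a s'

end MDP

namespace LMDP

variable {S A : Type*} [Fintype S] {M : LMDP S A} {x y : S → A → ℝ} {ε : ℝ}

theorem LPFeasible.congr (h : M.LPFeasible ε x y) {x' y' : S → A → ℝ}
    (hx : ∀ s, ∀ a ∈ M.avail s, x' s a = x s a) (hy : ∀ s, ∀ a ∈ M.avail s, y' s a = y s a) :
    M.LPFeasible ε x' y' := by
  obtain ⟨⟨h1, h2, h3, h4, h5⟩, h6, h7⟩ := h
  refine ⟨⟨fun s' => ?_, fun s' => ?_, ?_, fun s a ha => ?_, fun s a ha => ?_⟩, fun i => ?_,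
    fun s hs a ha => ?_⟩
  · rw [Finset.sum_congr rfl (hx s'), ← h1 s']
    exact Finset.sum_congr rfl fun s _ => Finset.sum_congr rfl fun a ha => by rw [hx s a ha]
  · have h : ∑ a ∈ M.avail s', (x' s' a + y' s' a) = ∑ a ∈ M.avail s', (x s' a + y s' a) :=
      Finset.sum_congr rfl fun a ha => by rw [hx s' a ha, hy s' a ha]
    rw [h, ← h2 s']
    exact Finset.sum_congr rfl fun s _ => Finset.sum_congr rfl fun a ha => by rw [hy s a ha]
  · rw [← h3]
    exact Finset.sum_congr rfl fun s _ => Finset.sum_congr rfl (hx s)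
  · rw [hx s a ha]
    exact h4 s a ha
  · rw [hy s a ha]
    exact h5 s a ha
  · rw [Finset.sum_congr rfl fun s _ => Finset.sum_congr rfl (hx s)]
    exact h6 i
  · rw [hx s a ha]
    exact h7 s hs a ha

theorem objective_congr {x' : S → A → ℝ} (hx : ∀ s, ∀ a ∈ M.avail s, x' s a = x s a) :
    M.objective x' = M.objective x :=
  Finset.sum_congr rfl fun s _ => Finset.sum_congr rfl fun a ha => by rw [hx s a ha]

theorem LPFeasible.flowMap_eq (h : M.LPFeasible ε x y) (s' : S) :
    M.flowMap (fun i => y i.1 i.2) s' = M.marg x s' - M.init s' := by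
  rw [M.flowMap_restrict, h.memQ0.flow s', Finset.sum_add_distrib, MDP.marg]
  ring

theorem LPFeasible.norm_flowMap_le (h : M.LPFeasible ε x y) :
    ‖M.flowMap fun i => y i.1 i.2‖ ≤ ∑ s, ((M.avail s).card : ℝ) + 1 := by
  have h0 : (0 : ℝ) ≤ ∑ s, ((M.avail s).card : ℝ) :=
    Finset.sum_nonneg fun s _ => Nat.cast_nonneg _
  rw [pi_norm_le_iff_of_nonneg (by linarith)]
  intro s'
  have h1 : M.marg x s' ≤ (M.avail s').card := by
    have := Finset.sum_le_card_nsmul (M.avail s') (x s') 1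
      fun a ha => (h.memQ0.x_mem s' a ha).2
    rwa [nsmul_one] at this
  have h2 : ((M.avail s').card : ℝ) ≤ ∑ s, ((M.avail s).card : ℝ) :=
    Finset.single_le_sum (f := fun s => ((M.avail s).card : ℝ)) (fun _ _ => Nat.cast_nonneg _)
      (Finset.mem_univ s')
  have h3 : M.init s' ≤ 1 := by
    rw [← M.init_sum]
    exact Finset.single_le_sum (fun s _ => M.init_nonneg s) (Finset.mem_univ s')
  have h4 := M.init_nonneg s'
  have h5 := h.memQ0.marg_x_nonneg s'
  rw [h.flowMap_eq, Real.norm_eq_abs, abs_le]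
  constructor <;> linarith

/-- Feasible points can be replaced by feasible points in a fixed box. -/
theorem exists_feasible_bounded (M : LMDP S A) :
    ∃ B : ℝ, ∀ ε x y, M.LPFeasible ε x y → ∃ x' y', M.LPFeasible ε x' y' ∧
      M.objective x' = M.objective x ∧ (∀ s a, x' s a ∈ Set.Icc 0 1) ∧
      ∀ s a, y' s a ∈ Set.Icc 0 B := by
  classical
  obtain ⟨K, hK0, hK⟩ := exists_bounded_nonneg_preimage M.flowMap
  refine ⟨K * (∑ s, ((M.avail s).card : ℝ) + 1), fun ε x y h => ?_⟩
  obtain ⟨z, hz0, hz, hzn⟩ := hK (fun i => y i.1 i.2) fun i => h.memQ0.y_nonneg i.1 i.2 i.2.2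
  set y₁ : S → A → ℝ := fun s a => if ha : a ∈ M.avail s then z ⟨s, a, ha⟩ else 0 with hy₁
  have hzy : z = fun i => y₁ i.1 i.2 := by
    funext ⟨s, a, ha⟩
    simp [hy₁, ha]
  have hy₁0 : ∀ s a, 0 ≤ y₁ s a := fun s a => by
    simp only [hy₁]
    split_ifs
    · exact hz0 _
    · exact le_rfl
  have h' : M.LPFeasible ε x y₁ := by
    refine ⟨⟨h.memQ0.stationary, fun s' => ?_, h.memQ0.transient, h.memQ0.x_mem,
      fun s a _ => hy₁0 s a⟩, h.specs, h.lower⟩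
    have := h.flowMap_eq s'
    rw [← hz, hzy, M.flowMap_restrict, MDP.marg] at this
    rw [Finset.sum_add_distrib]
    linarith
  -- The constraints ignore unavailable actions, where arbitrary values must be zeroed to land in
  -- the box.
  have hx₁ : ∀ s, ∀ a ∈ M.avail s, (if a ∈ M.avail s then x s a else 0) = x s a :=
    fun s a ha => if_pos ha
  refine ⟨fun s a => if a ∈ M.avail s then x s a else 0, y₁, h'.congr hx₁ fun _ _ _ => rfl,
    objective_congr hx₁, fun s a => ?_, fun s a => ⟨hy₁0 s a, ?_⟩⟩
  · dsimp only
    split_ifs with ha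
    · exact h.memQ0.x_mem s a ha
    · simp
  · simp only [hy₁]
    split_ifs with ha
    · exact ((le_abs_self _).trans (norm_le_pi_norm z ⟨s, a, ha⟩)).trans
        (hzn.trans (mul_le_mul_of_nonneg_left h.norm_flowMap_le hK0))
    · exact mul_nonneg hK0 ((norm_nonneg _).trans h.norm_flowMap_le)

theorem isClosed_feasible (M : LMDP S A) (ε : ℝ) :
    IsClosed {p : (S → A → ℝ) × (S → A → ℝ) | M.LPFeasible ε p.1 p.2} := by
  classical
  have heq : {p : (S → A → ℝ) × (S → A → ℝ) | M.LPFeasible ε p.1 p.2} =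
      {p | (∀ s', ∑ s, ∑ a ∈ M.avail s, p.1 s a * M.T s a s' = ∑ a ∈ M.avail s', p.1 s' a) ∧
        (∀ s', ∑ s, ∑ a ∈ M.avail s, p.2 s a * M.T s a s' =
          ∑ a ∈ M.avail s', (p.1 s' a + p.2 s' a) - M.init s') ∧
        (∑ f with f ∉ M.recurrentSet, ∑ a ∈ M.avail f, p.1 f a = 0) ∧
        (∀ s, ∀ a ∈ M.avail s, 0 ≤ p.1 s a) ∧ (∀ s, ∀ a ∈ M.avail s, p.1 s a ≤ 1) ∧
        (∀ s, ∀ a ∈ M.avail s, 0 ≤ p.2 s a) ∧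
        (∀ i, M.lo i ≤ ∑ s ∈ M.label i, ∑ a ∈ M.avail s, p.1 s a) ∧
        (∀ i, ∑ s ∈ M.label i, ∑ a ∈ M.avail s, p.1 s a ≤ M.hi i) ∧
        ∀ s ∈ M.recurrentSet, ∀ a ∈ M.avail s, ε ≤ p.1 s a} := by
    ext p
    constructor
    · rintro ⟨⟨h1, h2, h3, h4, h5⟩, h6, h7⟩
      exact ⟨h1, h2, by convert h3, fun s a ha => (h4 s a ha).1, fun s a ha => (h4 s a ha).2, h5,
        fun i => (h6 i).1, fun i => (h6 i).2, h7⟩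
    · rintro ⟨h1, h2, h3, h4, h4', h5, h6, h6', h7⟩
      exact ⟨⟨h1, h2, by convert h3, fun s a ha => ⟨h4 s a ha, h4' s a ha⟩, h5⟩,
        fun i => ⟨h6 i, h6' i⟩, h7⟩
  rw [heq]
  simp only [Set.ofPred_and, Set.ofPred_forall]
  refine .inter ?_ <| .inter ?_ <| .inter ?_ <| .inter ?_ <| .inter ?_ <| .inter ?_ <|
    .inter ?_ <| .inter ?_ ?_
  · exact isClosed_iInter fun s' => isClosed_eq (by fun_prop) (by fun_prop)
  · exact isClosed_iInter fun s' => isClosed_eq (by fun_prop) (by fun_prop)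
  · exact isClosed_eq (by fun_prop) (by fun_prop)
  · exact isClosed_iInter fun s => isClosed_iInter fun a => isClosed_iInter fun _ =>
      isClosed_le (by fun_prop) (by fun_prop)
  · exact isClosed_iInter fun s => isClosed_iInter fun a => isClosed_iInter fun _ =>
      isClosed_le (by fun_prop) (by fun_prop)
  · exact isClosed_iInter fun s => isClosed_iInter fun a => isClosed_iInter fun _ =>
      isClosed_le (by fun_prop) (by fun_prop)
  · exact isClosed_iInter fun i => isClosed_le (by fun_prop) (by fun_prop)
  · exact isClosed_iInter fun i => isClosed_le (by fun_prop) (by fun_prop)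
  · exact isClosed_iInter fun s => isClosed_iInter fun _ => isClosed_iInter fun a =>
      isClosed_iInter fun _ => isClosed_le (by fun_prop) (by fun_prop)

theorem LPFeasible.exists_optimal (h : M.LPFeasible ε x y) : ∃ x y, M.LPOptimal ε x y := by
  obtain ⟨B, hB⟩ := M.exists_feasible_bounded
  set box : Set ((S → A → ℝ) × (S → A → ℝ)) :=
    (Set.univ.pi fun _ => Set.univ.pi fun _ => Set.Icc 0 1) ×ˢ
      (Set.univ.pi fun _ => Set.univ.pi fun _ => Set.Icc 0 B) with hbox
  -- `A` may be infinite; compactness in the product topology is Tychonoff's theorem.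
  have hcomp : IsCompact box :=
    (isCompact_univ_pi fun _ => isCompact_univ_pi fun _ => isCompact_Icc).prod
      (isCompact_univ_pi fun _ => isCompact_univ_pi fun _ => isCompact_Icc)
  have hcont : Continuous fun p : (S → A → ℝ) × (S → A → ℝ) => M.objective p.1 := by
    unfold MDP.objective
    fun_prop
  obtain ⟨x₁, y₁, h₁, -, hx₁, hy₁⟩ := hB ε x y h
  obtain ⟨p, ⟨hpf, -⟩, hmax⟩ := (hcomp.inter_left (M.isClosed_feasible ε)).exists_isMaxOn
    ⟨(x₁, y₁), h₁, fun s _ a _ => hx₁ s a, fun s _ a _ => hy₁ s a⟩ hcont.continuousOn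
  refine ⟨p.1, p.2, hpf, fun x' y' h' => ?_⟩
  obtain ⟨x₂, y₂, h₂, hobj, hx₂, hy₂⟩ := hB ε x' y' h'
  rw [← hobj]
  exact hmax (a := (x₂, y₂)) ⟨h₂, fun s _ a _ => hx₂ s a, fun s _ a _ => hy₂ s a⟩

end LMDP

end

/-! ### Assembly and the limit `ε ↓ 0`. -/

theorem mainTheorem7 {S A : Type*} [Fintype S] (M : LMDP S A) :
    -- (1) policies obtained from feasible solutions are edge-preserving
    (∀ ε : ℝ, 0 < ε → ∀ x y π : S → A → ℝ,
      M.LPFeasible ε x y → M.IsInducedPolicy x y π → π ∈ M.edgePreserving) ∧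
    -- (2) the occupation measure of an edge-preserving policy meeting the specifications
    -- is feasible for some positive ε
    (∀ π ∈ M.edgePreserving, M.MeetsSpecs π →
      ∃ ε : ℝ, 0 < ε ∧ ∃ p y : S → A → ℝ, M.HasOccupationMeasure π p ∧ M.LPFeasible ε p y) ∧
    -- (3) if the synthesis problem is feasible, optimal solutions exist for all small ε and
    -- the rewards of the policies obtained from them tend to the supremum
    ((∃ π ∈ M.edgePreserving, M.MeetsSpecs π) →
      (∀ᶠ ε in 𝓝[>] (0 : ℝ), ∃ x y : S → A → ℝ, M.LPOptimal ε x y) ∧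
      ∃ V : ℝ, IsLUB {r : ℝ | ∃ π ∈ M.edgePreserving, M.MeetsSpecs π ∧ r = M.avgReward π} V ∧
        ∀ x y π : ℝ → S → A → ℝ,
          (∀ᶠ ε in 𝓝[>] (0 : ℝ),
            M.LPOptimal ε (x ε) (y ε) ∧ M.IsInducedPolicy (x ε) (y ε) (π ε)) →
          Tendsto (fun ε => V - M.avgReward (π ε)) (𝓝[>] 0) (𝓝 0)) := by
  refine ⟨fun ε hε x y π h hi => h.mem_edgePreserving hε hi,
    fun π hπ hs => LMDP.exists_feasible_of_edgePreserving hπ hs, ?_⟩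
  rintro ⟨π₀, hπ₀, hs₀⟩
  have hval : ∀ π ∈ M.edgePreserving, M.MeetsSpecs π →
      ∃ ε : ℝ, 0 < ε ∧ ∃ p y : S → A → ℝ, M.LPFeasible ε p y ∧
        M.avgReward π = M.objective p := by
    intro π hπ hs
    obtain ⟨ε, hε, p, y, hp, hf⟩ := LMDP.exists_feasible_of_edgePreserving hπ hs
    exact ⟨ε, hε, p, y, hf, hp.avgReward_eq⟩
  have hlub := isLUB_csSup
    (s := {r : ℝ | ∃ π ∈ M.edgePreserving, M.MeetsSpecs π ∧ r = M.avgReward π})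
    ⟨_, π₀, hπ₀, hs₀, rfl⟩ (by
      refine ⟨∑ s, ∑ a ∈ M.avail s, |M.meanReward s a|, ?_⟩
      rintro _ ⟨π, hπ, hs, rfl⟩
      obtain ⟨ε, -, p, y, hf, h⟩ := hval π hπ hs
      exact h ▸ hf.objective_le)
  refine ⟨?_, _, hlub, fun x y π hopt => ?_⟩
  · obtain ⟨ε, hε, p, y, hf, -⟩ := hval π₀ hπ₀ hs₀
    filter_upwards [Ioo_mem_nhdsGT hε] with ε' hε'
    exact (hf.mono hε'.2.le).exists_optimal
  · rw [Metric.tendsto_nhds]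
    intro δ hδ
    -- A policy within `δ` of the supremum is feasible for all `ε < ε₁`, which bounds the optimum
    -- below. The policy obtained from an optimum is itself admissible, which bounds it above.
    obtain ⟨_, ⟨π₁, hπ₁, hs₁, rfl⟩, hlt, -⟩ := hlub.exists_between (sub_lt_self _ hδ)
    obtain ⟨ε₁, hε₁, p, q, hf, hr⟩ := hval π₁ hπ₁ hs₁
    filter_upwards [hopt, Ioo_mem_nhdsGT hε₁] with ε ⟨ho, hi⟩ hε
    have h1 := ho.2 p q (hf.mono hε.2.le)
    have h2 := ho.1.avgReward_eq hε.1 hi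
    have h3 := hlub.1 ⟨π ε, ho.1.mem_edgePreserving hε.1 hi, ho.1.meetsSpecs hε.1 hi, rfl⟩
    rw [Real.dist_eq, sub_zero, abs_lt]
    constructor <;> linarith
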